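/- Let the Möbius band be $M=\mathbb R\times S^1/\!\sim$ with $(t,\theta)\sim(-t,\theta+\pi)$ ($S^1=\mathbb R/2\pi\mathbb Z$), and for $T>0$ let $M_T=[-T,T]\times S^1/\!\sim$ be the compact Möbius band. For a smooth Riemannian metric $g$ on $M_T$ let $L(g)$ be the length of $\partial M_T$. A Steklov eigenfunction of $(M_T,g)$ with eigenvalue $\sigma$ is a nonzero smooth function $u$ on $M_T$ with $\Delta_g u=0$ on $M_T$ and $\partial u/\partial\eta=\sigma u$ on $\partial M_T$, where $\eta$ is the outward unit conormal; $\sigma_1(g)$ is the least positive Steklov eigenvalue, and the eigenfunctions with this eigenvalue are the first Steklov eigenfunctions. The metric $g$ is rotationally symmetric if it is invariant under all maps $(t,\theta)\mapsto(t,\theta+a)$. Two bands $(M_{T_1},g_1)$ and $(M_{T_2},g_2)$ are $\sigma$-homothetic if there is a diffeomorphism $\Phi:M_{T_1}\to M_{T_2}$ with $\Phi^*g_2=\lambda^2g_1$ for a positive function $\lambda$ that is constant on $\partial M_{T_1}$. Consider $$\varphi(t,\theta)=(2\sinh t\cos\theta,\;2\sinh t\sin\theta,\;\cosh 2t\cos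 2\theta,\;\cosh 2t\sin 2\theta).$$ 1. $\varphi$ defines a smooth minimal embedding of $M$ into $\mathbb R^4$. 2. The equation $\coth t=2\tanh 2t$ has a unique positive solution $T_0$. Among all $T>0$, $T=T_0$ is the only one for which the restriction of $\varphi$ to $M_T$ is a proper embedding into a closed ball centred at the origin (the points mapped to the bounding sphere are exactly those of $\partial M_T$) whose coordinate functions are first Steklov eigenfunctions of the induced metric. For $T=T_0$ the radius of the ball is $R_0=\sqrt{4\sinh^2T_0+\cosh^2 2T_0}$, and the surface is a free boundary minimal surface: along its boundary its outward unit conormal equals the outward unit normal of the ball. Consequently the rescaled map $R_0^{-1}\varphi|_{M_{T_0}}$ is a free boundary minimal proper embedding into the unit ball by first Steklov eigenfunctions; $M_{T_0}$ with its induced metric $g_{cmb}$ is called the critical Möbius band. 3. For every $T>0$ and every rotationally symmetric smooth metric $g$ on $M_T$, the least positive Steklov eigenvalue $\sigma_1(g)$ exists and $\sigma_1(g)L(g)\le 2\pi\sqrt3$. The metric $g_{cmb}$ is rotationally symmetric and $\sigma_1(g_{cmb})L(g_{cmb})=2\pi\sqrt3$. If equality holds for a rotationally symmetric metric $g$ on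 $M_T$, then $(M_T,g)$ is $\sigma$-homothetic to the critical Möbius band. -/

import Mathlib

open Real Set
open scoped ContDiff

noncomputable section

namespace Mobius

/-! ## The Möbius band

The band is the quotient of the plane of pairs `(t, θ)` by the group generated by the glide
reflection `(t, θ) ↦ (-t, θ + π)`.  The square of the glide reflection is `(t, θ) ↦ (t, θ + 2π)`,
so this is `ℝ × S¹` with `(t, θ)` and `(-t, θ + π)` identified. -/

/-- The glide reflection `(t, θ) ↦ (-t, θ + π)`. -/
def deck : Equiv.Perm (ℝ × ℝ) where
  toFun p := (-p.1, p.2 + π)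
  invFun p := (-p.1, p.2 - π)
  left_inv p := by ext <;> simp
  right_inv p := by ext <;> simp

/-- Two points of the plane are identified when some integer power of `deck` maps one to
the other. -/
def deckSetoid : Setoid (ℝ × ℝ) := Equiv.Perm.SameCycle.setoid deck

/-- The (open, infinite) Möbius band, with the quotient topology. -/
abbrev Band : Type := Quotient deckSetoid

/-- The closed strip `[-T, T] × ℝ`, the universal cover of the compact Möbius band. -/
def strip (T : ℝ) : Set (ℝ × ℝ) := {p | |p.1| ≤ T}

/-- The compact Möbius band `[-T, T] × S¹ / ∼`, as a subset of the infinite one. -/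
def compactBand (T : ℝ) : Set Band := (Quotient.mk deckSetoid) '' strip T

/-- The coordinate vector `∂/∂t`. -/
def et : ℝ × ℝ := (1, 0)

/-- The coordinate vector `∂/∂θ`. -/
def eθ : ℝ × ℝ := (0, 1)

/-! ## Metrics on the compact Möbius band -/

/-- A smooth (up to the boundary) Riemannian metric `E dt² + 2 F dt dθ + G dθ²` on the compact
Möbius band of half-width `T`: a metric on the strip invariant under `deck`.  The values of the
coefficients off the strip are irrelevant. -/
structure Metric (T : ℝ) where
  E : ℝ × ℝ → ℝ
  F : ℝ × ℝ → ℝ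
  G : ℝ × ℝ → ℝ
  smooth_E : ContDiffOn ℝ ∞ E (strip T)
  smooth_F : ContDiffOn ℝ ∞ F (strip T)
  smooth_G : ContDiffOn ℝ ∞ G (strip T)
  E_pos : ∀ p ∈ strip T, 0 < E p
  det_pos : ∀ p ∈ strip T, 0 < E p * G p - F p ^ 2
  E_deck : ∀ p ∈ strip T, E (deck p) = E p
  F_deck : ∀ p ∈ strip T, F (deck p) = -F p
  G_deck : ∀ p ∈ strip T, G (deck p) = G p

namespace Metric

variable {T : ℝ}

/-- The inner product of the tangent vectors `v` and `w` at `p`. -/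
def form (g : Metric T) (p v w : ℝ × ℝ) : ℝ :=
  g.E p * (v.1 * w.1) + g.F p * (v.1 * w.2 + v.2 * w.1) + g.G p * (v.2 * w.2)

/-- The area density `√(EG - F²)`. -/
def density (g : Metric T) (p : ℝ × ℝ) : ℝ := √(g.E p * g.G p - g.F p ^ 2)

/-- The Laplace–Beltrami operator
`Δu = D⁻¹ (∂ₜ ((G uₜ - F u_θ) / D) + ∂_θ ((E u_θ - F uₜ) / D))`, where `D = √(EG - F²)`. -/
def laplacian (g : Metric T) (u : ℝ × ℝ → ℝ) (p : ℝ × ℝ) : ℝ :=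
  (g.density p)⁻¹ *
    (fderivWithin ℝ (fun q => (g.G q * fderivWithin ℝ u (strip T) q et
        - g.F q * fderivWithin ℝ u (strip T) q eθ) / g.density q) (strip T) p et
    + fderivWithin ℝ (fun q => (g.E q * fderivWithin ℝ u (strip T) q eθ
        - g.F q * fderivWithin ℝ u (strip T) q et) / g.density q) (strip T) p eθ)

/-- `v` is the outward unit conormal at the boundary point `p` (where `p.1 = T` or
`p.1 = -T`): it is a unit vector, orthogonal to the boundary, and points out of the strip. -/
def IsOutwardConormal (g : Metric T) (p v : ℝ × ℝ) : Prop :=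
  g.form p v v = 1 ∧ g.form p v eθ = 0 ∧ 0 < p.1 * v.1

/-- The length of the boundary.  The boundary of the band is a single circle, parametrized by
`θ ↦ (T, θ)`, `0 ≤ θ ≤ 2π`. -/
def boundaryLength (g : Metric T) : ℝ := ∫ θ in (0 : ℝ)..(2 * π), √(g.G (T, θ))

/-- `u` is a (nonzero) Steklov eigenfunction with eigenvalue `s`: a smooth function on the
Möbius band, harmonic, with outward normal derivative `s * u` along the boundary. In other words
the boundary values of `u` are an eigenfunction of the Dirichlet-to-Neumann map. -/
structure IsSteklovEigenfunction (g : Metric T) (s : ℝ) (u : ℝ × ℝ → ℝ) : Prop where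
  smooth : ContDiffOn ℝ ∞ u (strip T)
  deck_eq : ∀ p ∈ strip T, u (deck p) = u p
  ne_zero : ∃ p ∈ strip T, u p ≠ 0
  harmonic : ∀ p ∈ strip T, g.laplacian u p = 0
  boundary : ∀ p : ℝ × ℝ, |p.1| = T → ∀ v, g.IsOutwardConormal p v →
    fderivWithin ℝ u (strip T) p v = s * u p

/-- The set of positive Steklov eigenvalues. -/
def positiveSteklovSpectrum (g : Metric T) : Set ℝ :=
  {s | 0 < s ∧ ∃ u, g.IsSteklovEigenfunction s u}

/-- The first nonzero Steklov eigenvalue. -/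
def sigmaOne (g : Metric T) : ℝ := sInf g.positiveSteklovSpectrum

/-- `u` is a first Steklov eigenfunction: its eigenvalue is the least positive one. -/
def IsFirstSteklovEigenfunction (g : Metric T) (u : ℝ × ℝ → ℝ) : Prop :=
  IsLeast g.positiveSteklovSpectrum g.sigmaOne ∧ g.IsSteklovEigenfunction g.sigmaOne u

/-- The metric is invariant under all rotations `(t, θ) ↦ (t, θ + a)`. -/
def IsRotationallySymmetric (g : Metric T) : Prop :=
  ∀ p ∈ strip T, ∀ a : ℝ, g.E (p.1, p.2 + a) = g.E p ∧ g.F (p.1, p.2 + a) = g.F p ∧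
    g.G (p.1, p.2 + a) = g.G p

/-- Two Möbius bands are `σ`-homothetic: there is a conformal diffeomorphism between them whose
conformal factor `lam ^ 2` is constant along the boundary.  A diffeomorphism of Möbius bands is
given by a diffeomorphism `Φ` of the universal covers that, like its inverse `Ψ`, maps identified
points to identified points. -/
def SigmaHomothetic {T₁ T₂ : ℝ} (g₁ : Metric T₁) (g₂ : Metric T₂) : Prop :=
  ∃ (Φ Ψ : ℝ × ℝ → ℝ × ℝ) (lam : ℝ × ℝ → ℝ) (c : ℝ),
    ContDiffOn ℝ ∞ Φ (strip T₁) ∧ ContDiffOn ℝ ∞ Ψ (strip T₂) ∧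
    MapsTo Φ (strip T₁) (strip T₂) ∧ MapsTo Ψ (strip T₂) (strip T₁) ∧
    LeftInvOn Ψ Φ (strip T₁) ∧ RightInvOn Ψ Φ (strip T₂) ∧
    (∀ p ∈ strip T₁, ∀ q ∈ strip T₁, deckSetoid p q → deckSetoid (Φ p) (Φ q)) ∧
    (∀ p ∈ strip T₂, ∀ q ∈ strip T₂, deckSetoid p q → deckSetoid (Ψ p) (Ψ q)) ∧
    (∀ p ∈ strip T₁, 0 < lam p) ∧
    (∀ p ∈ strip T₁, ∀ v w, g₂.form (Φ p) (fderivWithin ℝ Φ (strip T₁) p v)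
      (fderivWithin ℝ Φ (strip T₁) p w) = lam p ^ 2 * g₁.form p v w) ∧
    (∀ p : ℝ × ℝ, |p.1| = T₁ → lam p = c)

end Metric

/-! ## Immersions of the Möbius band in Euclidean four-space -/

/-- Euclidean four-space. -/
abbrev E4 : Type := EuclideanSpace ℝ (Fin 4)

/-- A smooth immersion of the infinite Möbius band in `ℝ⁴`. -/
structure Immersion where
  toFun : ℝ × ℝ → E4
  smooth : ContDiff ℝ ∞ toFun
  deck_eq : ∀ p, toFun (deck p) = toFun p
  injective_fderiv : ∀ p, Function.Injective (fderiv ℝ toFun p)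

namespace Immersion

/-- The induced map on the quotient. -/
def onBand (ψ : Immersion) : Band → E4 :=
  Quotient.lift ψ.toFun (by
    have h : ∀ (n : ℕ) (p : ℝ × ℝ), ψ.toFun ((deck ^ n) p) = ψ.toFun p := by
      intro n
      induction n with
      | zero => intro p; simp
      | succ k ih => intro p; rw [pow_succ', Equiv.Perm.mul_apply, ψ.deck_eq, ih]
    rintro p q ⟨k, rfl⟩
    obtain ⟨n, rfl | rfl⟩ := k.eq_nat_or_neg
    · rw [zpow_natCast, h]
    · rw [zpow_neg, zpow_natCast, ← h n ((deck ^ n)⁻¹ p), ← Equiv.Perm.mul_apply,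
        mul_inv_cancel, Equiv.Perm.one_apply])

/-- The differential at `p` applied to `v`. -/
def d (ψ : Immersion) (p v : ℝ × ℝ) : E4 := fderiv ℝ ψ.toFun p v

theorem contDiff_d (ψ : Immersion) (v : ℝ × ℝ) : ContDiff ℝ ∞ (fun p => ψ.d p v) :=
  (ψ.smooth.fderiv_right (m := ∞) (by simp)).clm_apply contDiff_const

theorem d_deck (ψ : Immersion) (p v : ℝ × ℝ) : ψ.d (deck p) (-v.1, v.2) = ψ.d p v := by
  have hd : HasFDerivAt (fun q : ℝ × ℝ => deck q)
      ((-ContinuousLinearMap.fst ℝ ℝ ℝ).prod (ContinuousLinearMap.snd ℝ ℝ ℝ)) p :=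
    (hasFDerivAt_fst.neg).prodMk (hasFDerivAt_snd.add_const π)
  have h1 : HasFDerivAt ψ.toFun (fderiv ℝ ψ.toFun (deck p)) (deck p) :=
    (ψ.smooth.differentiable (by simp) _).hasFDerivAt
  have h2 := h1.comp p hd
  have h3 : (ψ.toFun ∘ fun q : ℝ × ℝ => deck q) = ψ.toFun := funext ψ.deck_eq
  rw [h3] at h2
  unfold d
  rw [h2.fderiv]
  simp

theorem d_ne_zero (ψ : Immersion) (p : ℝ × ℝ) {v : ℝ × ℝ} (hv : v ≠ 0) : ψ.d p v ≠ 0 := by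
  intro h
  exact hv (ψ.injective_fderiv p (by rw [map_zero]; exact h))

theorem d_add_smul (ψ : Immersion) (p v w : ℝ × ℝ) (a b : ℝ) :
    ψ.d p (a • v + b • w) = a • ψ.d p v + b • ψ.d p w := by
  simp [d]

/-- The metric induced from the Euclidean metric of `ℝ⁴`, restricted to the compact band. -/
def metric (ψ : Immersion) (T : ℝ) : Metric T where
  E p := inner ℝ (ψ.d p et) (ψ.d p et)
  F p := inner ℝ (ψ.d p et) (ψ.d p eθ)
  G p := inner ℝ (ψ.d p eθ) (ψ.d p eθ)
  smooth_E := ((ψ.contDiff_d et).inner ℝ (ψ.contDiff_d et)).contDiffOn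
  smooth_F := ((ψ.contDiff_d et).inner ℝ (ψ.contDiff_d eθ)).contDiffOn
  smooth_G := ((ψ.contDiff_d eθ).inner ℝ (ψ.contDiff_d eθ)).contDiffOn
  E_pos p _ := real_inner_self_pos.2 (ψ.d_ne_zero p (by simp [et]))
  det_pos p _ := by
    set x := ψ.d p et with hx
    set y := ψ.d p eθ with hy
    have hxp : 0 < inner ℝ x x := real_inner_self_pos.2 (ψ.d_ne_zero p (by simp [et]))
    have hz : inner ℝ x x • y + (-inner ℝ x y) • x ≠ 0 := by
      rw [hx, hy, ← ψ.d_add_smul]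
      apply ψ.d_ne_zero p
      intro h
      have := congrArg Prod.snd h
      simp only [et, eθ, Prod.snd_add, Prod.smul_snd, smul_eq_mul, mul_one, mul_zero, add_zero,
        Prod.snd_zero] at this
      exact hxp.ne' this
    have h := real_inner_self_pos.2 hz
    simp only [inner_add_left, inner_add_right, real_inner_smul_left, real_inner_smul_right] at h
    rw [real_inner_comm x y] at h
    by_contra hcon
    nlinarith
  E_deck p _ := by
    have h := ψ.d_deck p et
    have h' : ψ.d (deck p) et = -ψ.d p et := by
      rw [← h]; simp only [d, ← map_neg]; congr 1; simp [et]
    rw [h']; simp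
  F_deck p _ := by
    have h := ψ.d_deck p et
    have h' : ψ.d (deck p) et = -ψ.d p et := by
      rw [← h]; simp only [d, ← map_neg]; congr 1; simp [et]
    have h'' : ψ.d (deck p) eθ = ψ.d p eθ := by
      rw [← ψ.d_deck p eθ]; simp [eθ]
    rw [h', h'']; simp
  G_deck p _ := by
    have h'' : ψ.d (deck p) eθ = ψ.d p eθ := by
      rw [← ψ.d_deck p eθ]; simp [eθ]
    rw [h'']

/-- The second fundamental form: the normal component of the second derivative. -/
def secondFundamentalForm (ψ : Immersion) (p v w : ℝ × ℝ) : E4 :=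
  ((fderiv ℝ ψ.toFun p).range)ᗮ.starProjection (fderiv ℝ (fun q => ψ.d q w) p v)

/-- The mean curvature vector, the trace of the second fundamental form with respect to the
induced metric: `(G II(∂ₜ,∂ₜ) - 2 F II(∂ₜ,∂_θ) + E II(∂_θ,∂_θ)) / (EG - F²)`. -/
def meanCurvature (ψ : Immersion) (p : ℝ × ℝ) : E4 :=
  let E : ℝ := inner ℝ (ψ.d p et) (ψ.d p et)
  let F : ℝ := inner ℝ (ψ.d p et) (ψ.d p eθ)
  let G : ℝ := inner ℝ (ψ.d p eθ) (ψ.d p eθ)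
  (E * G - F ^ 2)⁻¹ • (G • ψ.secondFundamentalForm p et et
    - (2 * F) • ψ.secondFundamentalForm p et eθ + E • ψ.secondFundamentalForm p eθ eθ)

/-- The immersion is minimal. -/
def IsMinimal (ψ : Immersion) : Prop := ∀ p, ψ.meanCurvature p = 0

/-- The restriction of `ψ` to the compact band of half-width `T` is a proper embedding in the
closed ball of radius `R` about the origin: an embedding with image in the ball under which
exactly the boundary points of the band are mapped to the bounding sphere. -/
def IsProperEmbeddingInBall (ψ : Immersion) (T R : ℝ) : Prop :=
  Topology.IsEmbedding ((compactBand T).domRestrict ψ.onBand) ∧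
  ∀ p ∈ strip T, ‖ψ.toFun p‖ ≤ R ∧ (‖ψ.toFun p‖ = R ↔ |p.1| = T)

/-- The free boundary condition: the outward unit conormal of the surface agrees with the outward
unit normal of the ball of radius `R` along the boundary. -/
def MeetsBallOrthogonally (ψ : Immersion) (T R : ℝ) : Prop :=
  ∀ p : ℝ × ℝ, |p.1| = T → ∀ v, (ψ.metric T).IsOutwardConormal p v → ψ.d p v = R⁻¹ • ψ.toFun p

/-- The coordinate functions, restricted to the compact band, are first Steklov eigenfunctions of
the induced metric. -/
def IsByFirstEigenfunctions (ψ : Immersion) (T : ℝ) : Prop :=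
  ∀ i : Fin 4, (ψ.metric T).IsFirstSteklovEigenfunction (fun p => ψ.toFun p i)

/-- The dilation of `ψ` by the factor `c ≠ 0`. -/
def scale (ψ : Immersion) (c : ℝ) (hc : c ≠ 0) : Immersion where
  toFun p := c • ψ.toFun p
  smooth := ψ.smooth.const_smul c
  deck_eq p := by simp only [ψ.deck_eq]
  injective_fderiv p := by
    have h : fderiv ℝ (fun p => c • ψ.toFun p) p = c • fderiv ℝ ψ.toFun p :=
      fderiv_const_smul (ψ.smooth.differentiable (by simp) p) c
    rw [h]
    intro v w hvw
    exact ψ.injective_fderiv p (smul_right_injective _ hc hvw)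

end Immersion

/-! ## The explicit map -/

/-- `(2 sinh t cos θ, 2 sinh t sin θ, cosh 2t cos 2θ, cosh 2t sin 2θ)`. -/
def phiFun (p : ℝ × ℝ) : E4 :=
  !₂[2 * sinh p.1 * cos p.2, 2 * sinh p.1 * sin p.2,
    cosh (2 * p.1) * cos (2 * p.2), cosh (2 * p.1) * sin (2 * p.2)]

theorem contDiff_phiFun : ContDiff ℝ ∞ phiFun := by
  rw [contDiff_euclidean]
  intro i
  fin_cases i <;> simp [phiFun] <;> fun_prop

theorem fderiv_phiFun_apply (p v : ℝ × ℝ) : fderiv ℝ phiFun p v =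
    !₂[2 * (v.1 * cosh p.1 * cos p.2 - v.2 * sinh p.1 * sin p.2),
      2 * (v.1 * cosh p.1 * sin p.2 + v.2 * sinh p.1 * cos p.2),
      2 * (v.1 * sinh (2 * p.1) * cos (2 * p.2) - v.2 * cosh (2 * p.1) * sin (2 * p.2)),
      2 * (v.1 * sinh (2 * p.1) * sin (2 * p.2) + v.2 * cosh (2 * p.1) * cos (2 * p.2))] := by
  have hline : HasDerivAt (fun s : ℝ => p + s • v) v 0 := by
    simpa using ((hasDerivAt_id (0 : ℝ)).smul_const v).const_add p
  have h1 : HasDerivAt (fun s : ℝ => p.1 + s * v.1) v.1 0 := by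
    simpa using ((hasDerivAt_id (0 : ℝ)).mul_const v.1).const_add p.1
  have h2 : HasDerivAt (fun s : ℝ => p.2 + s * v.2) v.2 0 := by
    simpa using ((hasDerivAt_id (0 : ℝ)).mul_const v.2).const_add p.2
  have hf : HasFDerivAt phiFun (fderiv ℝ phiFun p) (p + (0 : ℝ) • v) := by
    simpa using (contDiff_phiFun.differentiable (by simp) p).hasFDerivAt
  have hc := hf.comp_hasDerivAt (0 : ℝ) hline
  have hi := hasDerivAt_pi.1
    ((PiLp.continuousLinearEquiv 2 ℝ (fun _ : Fin 4 => ℝ)).hasFDerivAt.comp_hasDerivAt 0 hc)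
  ext i
  have key := hi i
  refine key.unique ?_
  fin_cases i
  · refine (((h1.sinh.const_mul 2).mul h2.cos).congr_deriv ?_)
    simp; ring
  · refine (((h1.sinh.const_mul 2).mul h2.sin).congr_deriv ?_)
    simp; ring
  · refine (((h1.const_mul 2).cosh.mul (h2.const_mul 2).cos).congr_deriv ?_)
    simp; ring
  · refine (((h1.const_mul 2).cosh.mul (h2.const_mul 2).sin).congr_deriv ?_)
    simp; ring

theorem injective_fderiv_phiFun (p : ℝ × ℝ) : Function.Injective (fderiv ℝ phiFun p) := by
  rw [injective_iff_map_eq_zero]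
  intro v hv
  rw [fderiv_phiFun_apply] at hv
  have e0 := congrArg (fun x : E4 => x 0) hv
  have e1 := congrArg (fun x : E4 => x 1) hv
  have e2 := congrArg (fun x : E4 => x 2) hv
  have e3 := congrArg (fun x : E4 => x 3) hv
  simp at e0 e1 e2 e3
  have c1 : cosh p.1 * v.1 = 0 := by
    linear_combination cos p.2 * e0 + sin p.2 * e1 - (cosh p.1 * v.1) * sin_sq_add_cos_sq p.2
  have c2 : cosh (2 * p.1) * v.2 = 0 := by
    linear_combination (-sin (2 * p.2)) * e2 + cos (2 * p.2) * e3
      - (cosh (2 * p.1) * v.2) * sin_sq_add_cos_sq (2 * p.2)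
  ext
  · exact (mul_eq_zero.1 c1).resolve_left (cosh_pos _).ne'
  · exact (mul_eq_zero.1 c2).resolve_left (cosh_pos _).ne'

/-- The explicit immersion of the Möbius band in `ℝ⁴`. -/
def phi : Immersion where
  toFun := phiFun
  smooth := contDiff_phiFun
  deck_eq p := by
    have h : 2 * (p.2 + π) = 2 * p.2 + 2 * π := by ring
    simp [phiFun, deck, h]
  injective_fderiv := injective_fderiv_phiFun

/-- The radius of the ball: the common norm of the points `phi (±T, θ)`. -/
def radius (T : ℝ) : ℝ := √(4 * sinh T ^ 2 + cosh (2 * T) ^ 2)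

theorem radius_pos (T : ℝ) : 0 < radius T :=
  Real.sqrt_pos.2 (by have := cosh_pos (2 * T); positivity)

/-- The immersion `phi` rescaled so that the boundary `t = ±T` lies on the unit sphere.  For the
critical value of `T` this is the critical Möbius band. -/
def unitPhi (T : ℝ) : Immersion := phi.scale (radius T)⁻¹ (inv_ne_zero (radius_pos T).ne')

end Mobius

end

/-!
Write a rotationally symmetric metric as `E dt² + 2F dt dθ + G dθ²`, with coefficients depending
only on `t`, and let `D = √(EG - F²)`.  The functions `s = ∫ D/G dt` (odd) and `a = ∫ F/G dt` (even)
give coordinates `(s, θ + a)` in which the metric is `G` times the flat metric, and which commute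
with the glide reflection (`Metric.IsIsothermal`,
`Metric.IsRotationallySymmetric.exists_isIsothermal`).  Harmonicity is conformally invariant in
dimension two and `G` is constant on the boundary circle, so `√G σ₁` is the first eigenvalue of
the flat band of half-width `S = s T`.

On the flat band harmonic functions separate.  Invariance under the glide reflection selects the
modes `sinh(ns) cos(nθ + c)` for odd `n` and `cosh(ns) cos(nθ + c)` for even `n`, with eigenvalues
`n coth nS` and `n tanh nS`; the least positive one is `min (coth S) (2 tanh 2S)` (`flatSigma`).
That no smaller positive eigenvalue occurs is shown without passing to the flat band
(`Metric.IsIsothermal.flatSigma_le`): the coefficients `z = ∫ u χ dθ` and `q = ∫ P χ dθ`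
of an eigenfunction `u` and of its flux `P` along the mode `χ = cos(n(θ + a) + c)` satisfy
`z' = s' q`, `q' = n² s' z`.  If the eigenvalue were smaller, the parity of `z` and the boundary
condition would force all coefficients to vanish (`mode_coefficient_eq_zero`), and then `u = 0` by
completeness of the trigonometric system (`eq_zero_of_forall_integral_mul_cos`).

Therefore `σ₁ L = 2π min (coth S) (2 tanh 2S)`.  As `coth` decreases and `tanh` increases, the
maximum is attained exactly where the two agree, at `sinh² S = 1/2`, and equals `2π√3`.  In the case
of equality `S` is this critical half-width, and `(t, θ) ↦ (s, θ + a)` is the required conformal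
diffeomorphism (`Metric.IsIsothermal.sigmaHomothetic`).

The explicit map is conformal with harmonic coordinates, hence minimal; its norm is an increasing
function of `|t|`, so it is proper, and it separates the points of the band
(`isClosedEmbedding_phi`).  Its coordinates are the modes with `n = 1, 2`, whose eigenvalues agree
precisely at the critical half-width; there the conormal is parallel to the position vector
(`Immersion.IsDilationOfPhi.meetsBallOrthogonally`).
-/

noncomputable section

namespace Mobius

/-! ### Partial derivatives on the strip -/

theorem mem_strip {T t θ : ℝ} : (t, θ) ∈ strip T ↔ t ∈ Icc (-T) T := by
  simp only [strip, mem_ofPred_eq, mem_Icc, abs_le]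

theorem strip_eq_prod (T : ℝ) : strip T = Icc (-T) T ×ˢ (univ : Set ℝ) := by
  ext ⟨t, θ⟩
  simp [mem_strip]

theorem deck_mem_strip {T : ℝ} {p : ℝ × ℝ} (hp : p ∈ strip T) : deck p ∈ strip T := by
  simpa [strip, deck] using hp

theorem uniqueDiffOn_strip {T : ℝ} (hT : 0 < T) : UniqueDiffOn ℝ (strip T) := by
  rw [strip_eq_prod]
  exact (uniqueDiffOn_Icc (by linarith)).prod uniqueDiffOn_univ

/-- The partial derivative `∂f/∂t` on the strip, one-sided at the boundary. -/
abbrev partialT (T : ℝ) (f : ℝ × ℝ → ℝ) (p : ℝ × ℝ) : ℝ := fderivWithin ℝ f (strip T) p et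

/-- The partial derivative `∂f/∂θ` on the strip. -/
abbrev partialθ (T : ℝ) (f : ℝ × ℝ → ℝ) (p : ℝ × ℝ) : ℝ := fderivWithin ℝ f (strip T) p eθ

theorem hasDerivWithinAt_partialT {T t θ : ℝ} {f : ℝ × ℝ → ℝ}
    (hf : DifferentiableWithinAt ℝ f (strip T) (t, θ)) :
    HasDerivWithinAt (fun r => f (r, θ)) (partialT T f (t, θ)) (Icc (-T) T) t := by
  have h : HasDerivWithinAt (fun r : ℝ => (r, θ)) et (Icc (-T) T) t :=
    (hasDerivWithinAt_id t _).prodMk (hasDerivWithinAt_const t _ θ)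
  exact hf.hasFDerivWithinAt.comp_hasDerivWithinAt t h fun r hr => mem_strip.2 hr

theorem hasDerivAt_partialθ {T t θ : ℝ} {f : ℝ × ℝ → ℝ} (ht : t ∈ Icc (-T) T)
    (hf : DifferentiableWithinAt ℝ f (strip T) (t, θ)) :
    HasDerivAt (fun r => f (t, r)) (partialθ T f (t, θ)) θ := by
  have h : HasDerivWithinAt (fun r : ℝ => (t, r)) eθ univ θ :=
    (hasDerivWithinAt_const θ _ t).prodMk (hasDerivWithinAt_id θ _)
  exact (hf.hasFDerivWithinAt.comp_hasDerivWithinAt θ h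
    fun r _ => mem_strip.2 ht).hasDerivAt Filter.univ_mem

theorem partialT_eq {T t θ d : ℝ} (hT : 0 < T) {f : ℝ × ℝ → ℝ} (ht : t ∈ Icc (-T) T)
    (hf : DifferentiableWithinAt ℝ f (strip T) (t, θ))
    (hd : HasDerivWithinAt (fun r => f (r, θ)) d (Icc (-T) T) t) : partialT T f (t, θ) = d :=
  (uniqueDiffOn_Icc (by linarith : -T < T) t ht).eq_deriv _ (hasDerivWithinAt_partialT hf) hd

theorem partialθ_eq {T t θ d : ℝ} {f : ℝ × ℝ → ℝ} (ht : t ∈ Icc (-T) T)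
    (hf : DifferentiableWithinAt ℝ f (strip T) (t, θ))
    (hd : HasDerivAt (fun r => f (t, r)) d θ) : partialθ T f (t, θ) = d :=
  (hasDerivAt_partialθ ht hf).unique hd

theorem contDiffOn_partial {T : ℝ} (hT : 0 < T) {f : ℝ × ℝ → ℝ}
    (hf : ContDiffOn ℝ ∞ f (strip T)) (v : ℝ × ℝ) :
    ContDiffOn ℝ ∞ (fun p => fderivWithin ℝ f (strip T) p v) (strip T) :=
  (hf.fderivWithin (uniqueDiffOn_strip hT) (by simp)).clm_apply contDiffOn_const

theorem fderivWithin_apply_eq (T : ℝ) (f : ℝ × ℝ → ℝ) (p v : ℝ × ℝ) :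
    fderivWithin ℝ f (strip T) p v = v.1 * partialT T f p + v.2 * partialθ T f p := by
  have h : v = v.1 • et + v.2 • eθ := by ext <;> simp [et, eθ]
  conv_lhs => rw [h]
  simp

theorem contDiffOn_comp_fst {T : ℝ} {f : ℝ → ℝ} (hf : ContDiffOn ℝ ∞ f (Icc (-T) T)) :
    ContDiffOn ℝ ∞ (fun p : ℝ × ℝ => f p.1) (strip T) :=
  hf.comp contDiffOn_fst fun _ hp => abs_le.1 hp

theorem differentiableWithinAt_of_contDiffOn {T : ℝ} {f : ℝ × ℝ → ℝ} {p : ℝ × ℝ}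
    (hf : ContDiffOn ℝ ∞ f (strip T)) (hp : p ∈ strip T) :
    DifferentiableWithinAt ℝ f (strip T) p :=
  hf.differentiableOn (by simp) p hp

/-! ### Conormal flux -/

namespace Metric

variable {T : ℝ}

theorem G_pos (g : Metric T) {p : ℝ × ℝ} (hp : p ∈ strip T) : 0 < g.G p := by
  have h1 := g.E_pos p hp
  have h2 := g.det_pos p hp
  by_contra h
  nlinarith [sq_nonneg (g.F p), mul_nonneg h1.le (not_lt.1 h |> neg_nonneg.2)]

theorem density_pos (g : Metric T) {p : ℝ × ℝ} (hp : p ∈ strip T) : 0 < g.density p :=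
  Real.sqrt_pos.2 (g.det_pos p hp)

theorem density_sq (g : Metric T) {p : ℝ × ℝ} (hp : p ∈ strip T) :
    g.density p ^ 2 = g.E p * g.G p - g.F p ^ 2 :=
  Real.sq_sqrt (g.det_pos p hp).le

theorem E_mul_G (g : Metric T) {p : ℝ × ℝ} (hp : p ∈ strip T) :
    g.E p * g.G p = g.density p ^ 2 + g.F p ^ 2 := by
  rw [g.density_sq hp]; ring

theorem contDiffOn_density (g : Metric T) : ContDiffOn ℝ ∞ g.density (strip T) :=
  ((g.smooth_E.mul g.smooth_G).sub (g.smooth_F.pow 2)).sqrt fun p hp => (g.det_pos p hp).ne'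

theorem density_deck (g : Metric T) {p : ℝ × ℝ} (hp : p ∈ strip T) :
    g.density (deck p) = g.density p := by
  simp only [density, g.E_deck p hp, g.F_deck p hp, g.G_deck p hp, neg_sq]

/-- The component `√(EG - F²) (∇u)ᵗ` of the density-weighted gradient of `u`: the flux of `∇u`
through the circles `t = const` per unit of `θ`. -/
def fluxT (g : Metric T) (u : ℝ × ℝ → ℝ) (q : ℝ × ℝ) : ℝ :=
  (g.G q * partialT T u q - g.F q * partialθ T u q) / g.density q

/-- The component `√(EG - F²) (∇u)^θ` of the density-weighted gradient of `u`. -/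
def fluxθ (g : Metric T) (u : ℝ × ℝ → ℝ) (q : ℝ × ℝ) : ℝ :=
  (g.E q * partialθ T u q - g.F q * partialT T u q) / g.density q

theorem laplacian_eq (g : Metric T) (u : ℝ × ℝ → ℝ) (p : ℝ × ℝ) :
    g.laplacian u p
      = (g.density p)⁻¹ * (partialT T (g.fluxT u) p + partialθ T (g.fluxθ u) p) := rfl

theorem contDiffOn_fluxT (g : Metric T) (hT : 0 < T) {u : ℝ × ℝ → ℝ}
    (hu : ContDiffOn ℝ ∞ u (strip T)) : ContDiffOn ℝ ∞ (g.fluxT u) (strip T) :=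
  ((g.smooth_G.mul (contDiffOn_partial hT hu et)).sub
    (g.smooth_F.mul (contDiffOn_partial hT hu eθ))).div g.contDiffOn_density
    fun _ hp => (g.density_pos hp).ne'

theorem contDiffOn_fluxθ (g : Metric T) (hT : 0 < T) {u : ℝ × ℝ → ℝ}
    (hu : ContDiffOn ℝ ∞ u (strip T)) : ContDiffOn ℝ ∞ (g.fluxθ u) (strip T) :=
  ((g.smooth_E.mul (contDiffOn_partial hT hu eθ)).sub
    (g.smooth_F.mul (contDiffOn_partial hT hu et))).div g.contDiffOn_density
    fun _ hp => (g.density_pos hp).ne'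

/-- The derivative of `u` along the outward conormal is `± fluxT / √G`, with the sign of `t`. -/
theorem IsOutwardConormal.fderivWithin_eq {g : Metric T} {p v : ℝ × ℝ}
    (hv : g.IsOutwardConormal p v) (hp : p ∈ strip T) (u : ℝ × ℝ → ℝ) :
    fderivWithin ℝ u (strip T) p v = SignType.sign p.1 * (g.fluxT u p / √(g.G p)) := by
  obtain ⟨h1, h2, h3⟩ := hv
  have hG := g.G_pos hp
  have hD := g.density_pos hp
  have hD2 := g.density_sq hp
  have hr := Real.sqrt_pos.2 hG
  have hr2 := Real.sq_sqrt hG.le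
  set r := √(g.G p)
  set D := g.density p
  simp only [form, eθ, mul_zero, mul_one, zero_add] at h1 h2
  have hv2 : v.2 = -(g.F p * v.1) / r ^ 2 := by
    rw [hr2]; field_simp; linarith
  -- The unit and orthogonality conditions leave `v.1 = ± √G / D`.
  have hsq : (v.1 * D) ^ 2 = r ^ 2 := by
    rw [hr2]
    have : (v.1 * D) ^ 2 = v.1 ^ 2 * (g.E p * g.G p - g.F p ^ 2) := by rw [mul_pow, hD2]
    rw [this]
    linear_combination g.G p * h1 - (g.F p * v.1 + g.G p * v.2) * h2
  have hfl : fderivWithin ℝ u (strip T) p v = v.1 * D * (g.fluxT u p / r ^ 2) := by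
    rw [fderivWithin_apply_eq, hv2, fluxT, ← hr2]
    change _ = v.1 * D * ((r ^ 2 * partialT T u p - g.F p * partialθ T u p) / D / r ^ 2)
    field_simp
    ring
  rw [hfl]
  rcases lt_trichotomy p.1 0 with h | h | h
  · have hv1 : v.1 < 0 := by nlinarith
    have : v.1 * D = -r := by nlinarith [mul_neg_of_neg_of_pos hv1 hD]
    rw [this, sign_neg h, SignType.coe_neg_one]
    field_simp
  · simp [h] at h3
  · have hv1 : 0 < v.1 := by nlinarith
    have : v.1 * D = r := by nlinarith [mul_pos hv1 hD]
    rw [this, sign_pos h, SignType.coe_one]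
    field_simp

theorem isOutwardConormal_of_pos (g : Metric T) {p : ℝ × ℝ} (hp : p ∈ strip T) (h0 : 0 < p.1) :
    g.IsOutwardConormal p (√(g.G p) / g.density p, -g.F p / (g.density p * √(g.G p))) := by
  have hG := g.G_pos hp
  have hD := g.density_pos hp
  have hD2 := g.density_sq hp
  have hr := Real.sqrt_pos.2 hG
  have hr2 := Real.sq_sqrt hG.le
  refine ⟨?_, ?_, by simp only; positivity⟩
  · simp only [form]
    set r := √(g.G p)
    set D := g.density p
    field_simp
    rw [hr2, hD2]
    ring
  · simp only [form, eθ]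
    set r := √(g.G p)
    set D := g.density p
    rw [← hr2]
    field_simp
    ring

/-! ### Isothermal coordinates and separated solutions -/

/-- `(t, θ) ↦ (s t, θ + a t)` is an isothermal coordinate system: it pulls the flat metric
`ds² + dθ²` back to `G⁻¹ g`, and it commutes with the glide reflection.  Moreover the conformal
factor `G` is constant along the boundary. -/
structure IsIsothermal (g : Metric T) (s a : ℝ → ℝ) : Prop where
  contDiffOn_s : ContDiffOn ℝ ∞ s (Icc (-T) T)
  contDiffOn_a : ContDiffOn ℝ ∞ a (Icc (-T) T)
  s_neg : ∀ t, s (-t) = -s t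
  a_neg : ∀ t, a (-t) = a t
  hasDeriv_s : ∀ t θ, t ∈ Icc (-T) T →
    HasDerivWithinAt s (g.density (t, θ) / g.G (t, θ)) (Icc (-T) T) t
  hasDeriv_a : ∀ t θ, t ∈ Icc (-T) T →
    HasDerivWithinAt a (g.F (t, θ) / g.G (t, θ)) (Icc (-T) T) t
  G_boundary : ∀ θ, g.G (T, θ) = g.G (T, 0)

namespace IsIsothermal

variable {g : Metric T} {s a : ℝ → ℝ}

theorem s_zero (H : g.IsIsothermal s a) : s 0 = 0 := by
  have := H.s_neg 0
  rw [neg_zero] at this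
  linarith

theorem s_strictMonoOn (H : g.IsIsothermal s a) : StrictMonoOn s (Icc (-T) T) := by
  refine strictMonoOn_of_hasDerivWithinAt_pos (convex_Icc _ _) H.contDiffOn_s.continuousOn
    (f' := fun t => g.density (t, 0) / g.G (t, 0)) ?_ ?_
  · exact fun t ht => (H.hasDeriv_s t 0 (interior_subset ht)).mono interior_subset
  · exact fun t ht => div_pos (g.density_pos (mem_strip.2 (interior_subset ht)))
      (g.G_pos (mem_strip.2 (interior_subset ht)))

theorem s_T_pos (H : g.IsIsothermal s a) (hT : 0 < T) : 0 < s T := by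
  rw [← H.s_zero]
  exact H.s_strictMonoOn ⟨by linarith, hT.le⟩ ⟨by linarith, le_rfl⟩ hT

theorem G_of_abs_eq (H : g.IsIsothermal s a) {p : ℝ × ℝ} (hp : |p.1| = T) :
    g.G p = g.G (T, 0) := by
  obtain ⟨t, θ⟩ := p
  have h0 : (0 : ℝ) ≤ T := hp ▸ abs_nonneg t
  rcases eq_or_eq_neg_of_abs_eq hp with h | h
  · simp only at h
    rw [h, H.G_boundary]
  · simp only at h
    have h1 := g.G_deck (t, θ) (mem_strip.2 (by rw [h]; constructor <;> linarith))
    rw [← h1, h]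
    simp [deck, H.G_boundary]

/-- The separated function `h(s) cos(k(θ + a) + c)`. -/
def mode (s a h : ℝ → ℝ) (k c : ℝ) (p : ℝ × ℝ) : ℝ := h (s p.1) * cos (k * (p.2 + a p.1) + c)

variable {h h' : ℝ → ℝ} {k c : ℝ}

theorem contDiffOn_mode (H : g.IsIsothermal s a) (hh : ContDiff ℝ ∞ h) :
    ContDiffOn ℝ ∞ (mode s a h k c) (strip T) := by
  have h1 := contDiffOn_comp_fst H.contDiffOn_s
  have h2 := contDiffOn_comp_fst H.contDiffOn_a
  exact (hh.comp_contDiffOn h1).mul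
    (contDiff_cos.comp_contDiffOn ((contDiffOn_const.mul (contDiffOn_snd.add h2)).add
      contDiffOn_const))

theorem partialT_mode (H : g.IsIsothermal s a) (hT : 0 < T) (hh : ContDiff ℝ ∞ h)
    (hd : ∀ x, HasDerivAt h (h' x) x) {t θ : ℝ} (ht : t ∈ Icc (-T) T) :
    partialT T (mode s a h k c) (t, θ) =
      h' (s t) * (g.density (t, θ) / g.G (t, θ)) * cos (k * (θ + a t) + c)
        - h (s t) * (k * (g.F (t, θ) / g.G (t, θ)) * sin (k * (θ + a t) + c)) := by
  refine partialT_eq hT ht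
    (differentiableWithinAt_of_contDiffOn (H.contDiffOn_mode hh) (mem_strip.2 ht)) ?_
  have h1 := (hd (s t)).comp_hasDerivWithinAt t (H.hasDeriv_s t θ ht)
  have h2 := ((((H.hasDeriv_a t θ ht).const_add θ).const_mul k).add_const c).cos
  refine (h1.mul h2).congr_deriv ?_
  simp only [Function.comp_apply]
  ring

theorem partialθ_mode (H : g.IsIsothermal s a) (hh : ContDiff ℝ ∞ h)
    {t θ : ℝ} (ht : t ∈ Icc (-T) T) :
    partialθ T (mode s a h k c) (t, θ) = -(h (s t) * (k * sin (k * (θ + a t) + c))) := by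
  refine partialθ_eq ht
    (differentiableWithinAt_of_contDiffOn (H.contDiffOn_mode hh) (mem_strip.2 ht)) ?_
  have h2 := (((((hasDerivAt_id θ).add_const (a t)).const_mul k).add_const c).cos).const_mul
    (h (s t))
  refine h2.congr_deriv ?_
  simp only [id_eq]
  ring

theorem fluxT_mode (H : g.IsIsothermal s a) (hT : 0 < T) (hh : ContDiff ℝ ∞ h)
    (hd : ∀ x, HasDerivAt h (h' x) x) {p : ℝ × ℝ} (hp : p ∈ strip T) :
    g.fluxT (mode s a h k c) p = mode s a h' k c p := by
  obtain ⟨t, θ⟩ := p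
  have hG := (g.G_pos hp).ne'
  have hD := (g.density_pos hp).ne'
  rw [fluxT, H.partialT_mode hT hh hd (mem_strip.1 hp), H.partialθ_mode hh (mem_strip.1 hp)]
  simp only [mode]
  field_simp
  ring

/-- The separated function is harmonic when `h'' = k² h`. -/
theorem laplacian_mode (H : g.IsIsothermal s a) (hT : 0 < T) (hh : ContDiff ℝ ∞ h)
    (hh' : ContDiff ℝ ∞ h') (hd : ∀ x, HasDerivAt h (h' x) x)
    (hd' : ∀ x, HasDerivAt h' (k ^ 2 * h x) x) {p : ℝ × ℝ} (hp : p ∈ strip T) :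
    g.laplacian (mode s a h k c) p = 0 := by
  have hu := H.contDiffOn_mode (k := k) (c := c) hh
  obtain ⟨t, θ⟩ := p
  have ht := mem_strip.1 hp
  have hP : partialT T (g.fluxT (mode s a h k c)) (t, θ)
      = partialT T (mode s a h' k c) (t, θ) := by
    rw [partialT, fderivWithin_congr (fun q hq => H.fluxT_mode hT hh hd hq)
      (H.fluxT_mode hT hh hd hp)]
  have hQ : partialθ T (g.fluxθ (mode s a h k c)) (t, θ) =
      -(g.density (t, 0) / g.G (t, 0)) * h (s t) * k ^ 2 * cos (k * (θ + a t) + c)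
      + g.F (t, 0) / g.G (t, 0) * h' (s t) * k * sin (k * (θ + a t) + c) := by
    refine partialθ_eq ht
      (differentiableWithinAt_of_contDiffOn (g.contDiffOn_fluxθ hT hu) hp) ?_
    have hX : ∀ r : ℝ, HasDerivAt (fun r => k * (r + a t) + c) k r := fun r =>
      (((hasDerivAt_id r).add_const (a t)).const_mul k).add_const c |>.congr_deriv (by simp)
    have h1 := ((hX θ).sin.const_mul (-(g.density (t, 0) / g.G (t, 0)) * h (s t) * k)).sub
      ((hX θ).cos.const_mul (g.F (t, 0) / g.G (t, 0) * h' (s t)))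
    refine (h1.congr_of_eventuallyEq (Filter.Eventually.of_forall fun r => ?_)).congr_deriv
      (by ring)
    have hr : (t, r) ∈ strip T := mem_strip.2 ht
    have e1 := (uniqueDiffOn_Icc (by linarith : -T < T) t ht).eq_deriv _
      (H.hasDeriv_s t 0 ht) (H.hasDeriv_s t r ht)
    have e2 := (uniqueDiffOn_Icc (by linarith : -T < T) t ht).eq_deriv _
      (H.hasDeriv_a t 0 ht) (H.hasDeriv_a t r ht)
    simp only [fluxθ, Pi.sub_apply]
    rw [H.partialT_mode hT hh hd ht, H.partialθ_mode hh ht, e1, e2]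
    have hG := (g.G_pos hr).ne'
    have hD := (g.density_pos hr).ne'
    have hE := g.E_mul_G hr
    field_simp
    linear_combination (-(h (s t) * k * sin (k * (r + a t) + c))) * hE
  have e1 := (uniqueDiffOn_Icc (by linarith : -T < T) t ht).eq_deriv _
    (H.hasDeriv_s t 0 ht) (H.hasDeriv_s t θ ht)
  have e2 := (uniqueDiffOn_Icc (by linarith : -T < T) t ht).eq_deriv _
    (H.hasDeriv_a t 0 ht) (H.hasDeriv_a t θ ht)
  rw [laplacian_eq, hP, hQ, H.partialT_mode hT hh' hd' ht, e1, e2]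
  ring

/-- A separated harmonic function descends to the band when it is invariant under the glide
reflection (`hsymm`), and it is an eigenfunction when `h' = ± μ h` at `s = ± s T`. -/
theorem isSteklovEigenfunction_mode (H : g.IsIsothermal s a) (hT : 0 < T) (hh : ContDiff ℝ ∞ h)
    (hh' : ContDiff ℝ ∞ h') (hd : ∀ x, HasDerivAt h (h' x) x)
    (hd' : ∀ x, HasDerivAt h' (k ^ 2 * h x) x) (hk : k ≠ 0)
    (hsymm : ∀ x y, h (-x) * cos (k * (y + π) + c) = h x * cos (k * y + c))
    {μ : ℝ} (h0 : h (s T) ≠ 0) (hb : h' (s T) = μ * h (s T))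
    (hb' : h' (-s T) = -(μ * h (-s T))) :
    g.IsSteklovEigenfunction (μ / √(g.G (T, 0))) (mode s a h k c) where
  smooth := H.contDiffOn_mode hh
  deck_eq p _ := by
    simp only [mode, deck, Equiv.coe_fn_mk, H.s_neg, H.a_neg]
    rw [← hsymm (s p.1) (p.2 + a p.1)]
    ring_nf
  ne_zero := by
    refine ⟨(T, -c / k - a T), mem_strip.2 ⟨by linarith, le_rfl⟩, ?_⟩
    have : k * (-c / k - a T + a T) + c = 0 := by field_simp; ring
    simp only [mode]
    rw [this, cos_zero, mul_one]
    exact h0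
  harmonic p hp := H.laplacian_mode hT hh hh' hd hd' hp
  boundary p hp v hv := by
    have hps : p ∈ strip T := hp.le
    rw [hv.fderivWithin_eq hps, H.fluxT_mode hT hh hd hps, H.G_of_abs_eq hp]
    simp only [mode]
    rcases eq_or_eq_neg_of_abs_eq hp with h | h
    · rw [h, sign_pos hT, hb, SignType.coe_one]
      ring
    · rw [h, sign_neg (by linarith), H.s_neg, hb', SignType.coe_neg_one]
      ring

theorem isSteklovEigenfunction_sinh (H : g.IsIsothermal s a) (hT : 0 < T) {A : ℝ} (hA : A ≠ 0)
    (c : ℝ) : g.IsSteklovEigenfunction (cosh (s T) / sinh (s T) / √(g.G (T, 0)))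
      (mode s a (fun x => A * sinh x) 1 c) := by
  have hS := Real.sinh_pos_iff.2 (H.s_T_pos hT)
  refine H.isSteklovEigenfunction_mode (h' := fun x => A * cosh x) hT (by fun_prop) (by fun_prop)
    (fun x => (hasDerivAt_sinh x).const_mul A)
    (fun x => ((hasDerivAt_cosh x).const_mul A).congr_deriv (by ring)) one_ne_zero
    (fun x y => ?_) (mul_ne_zero hA hS.ne') ?_ ?_
  · rw [one_mul, one_mul, show y + π + c = y + c + π by ring, cos_add_pi, sinh_neg]
    ring
  · field_simp
  · rw [cosh_neg, sinh_neg]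
    field_simp

theorem isSteklovEigenfunction_cosh (H : g.IsIsothermal s a) (hT : 0 < T) {A : ℝ} (hA : A ≠ 0)
    (c : ℝ) : g.IsSteklovEigenfunction (2 * tanh (2 * s T) / √(g.G (T, 0)))
      (mode s a (fun x => A * cosh (2 * x)) 2 c) := by
  have hC := Real.cosh_pos (2 * s T)
  have hX : ∀ x : ℝ, HasDerivAt (fun x => 2 * x) 2 x := fun x => by
    simpa using (hasDerivAt_id x).const_mul 2
  refine H.isSteklovEigenfunction_mode (h' := fun x => A * (2 * sinh (2 * x))) hT (by fun_prop)
    (by fun_prop) (fun x => ((hX x).cosh.const_mul A).congr_deriv (by ring))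
    (fun x => (((hX x).sinh.const_mul 2).const_mul A).congr_deriv (by ring)) two_ne_zero
    (fun x y => ?_) (mul_ne_zero hA hC.ne') ?_ ?_
  · rw [show 2 * (y + π) + c = 2 * y + c + 2 * π by ring, cos_add_two_pi, mul_neg, cosh_neg]
  · rw [tanh_eq_sinh_div_cosh]
    field_simp
  · rw [mul_neg, cosh_neg, sinh_neg, tanh_eq_sinh_div_cosh]
    field_simp

end IsIsothermal

end Metric

/-! ### Hyperbolic inequalities -/

theorem tanh_lt_tanh {x y : ℝ} (h : x < y) : tanh x < tanh y := by
  rw [tanh_eq_sinh_div_cosh, tanh_eq_sinh_div_cosh, div_lt_div_iff₀ (cosh_pos x) (cosh_pos y)]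
  have := Real.sinh_pos_iff.2 (sub_pos.2 h)
  rw [sinh_sub] at this
  linarith [mul_comm (cosh y) (sinh x)]

theorem coth_lt_coth {x y : ℝ} (hx : 0 < x) (h : x < y) :
    cosh y / sinh y < cosh x / sinh x := by
  rw [div_lt_div_iff₀ (Real.sinh_pos_iff.2 (hx.trans h)) (Real.sinh_pos_iff.2 hx)]
  have := Real.sinh_pos_iff.2 (sub_pos.2 h)
  rw [sinh_sub] at this
  linarith [mul_comm (cosh x) (sinh y)]

/-- Among the odd modes the first one has the least eigenvalue: `x coth x` is increasing along
the multiples of `S`. -/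
theorem sinh_mul_cosh_le {S : ℝ} (hS : 0 < S) (m : ℕ) :
    sinh (m * S) * cosh S ≤ m * cosh (m * S) * sinh S := by
  induction m with
  | zero => simp
  | succ k ih =>
    have e : ((k + 1 : ℕ) : ℝ) * S = k * S + S := by push_cast; ring
    have h1 : 0 ≤ sinh (k * S) := Real.sinh_nonneg_iff.2 (by positivity)
    have h2 : 0 < sinh S := Real.sinh_pos_iff.2 hS
    have h3 := cosh_pos S
    rw [e, sinh_add, cosh_add]
    push_cast
    have h4 := mul_le_mul_of_nonneg_right ih h3.le
    have h5 : 0 ≤ ((k : ℝ) + 1) * (sinh (k * S) * sinh S) * sinh S := by positivity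
    nlinarith

/-! ### Functions orthogonal to all trigonometric modes -/

/-- Completeness of the trigonometric system: all complex Fourier coefficients of `f` vanish, so its
Fourier series is summable and converges pointwise to `f`. -/
theorem eq_zero_of_forall_integral_mul_cos {f : ℝ → ℝ} (hf : Continuous f)
    (hper : Function.Periodic f (2 * π))
    (h : ∀ (n : ℤ) (c : ℝ), ∫ x in (0 : ℝ)..(2 * π), f x * cos (n * x + c) = 0) (x : ℝ) :
    f x = 0 := by
  have : Fact (0 < 2 * π) := ⟨two_pi_pos⟩
  have hperC : Function.Periodic (fun x => (f x : ℂ)) (2 * π) := fun x => by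
    simp only [hper x]
  have hc : Continuous (hperC.lift) :=
    continuous_coinduced_dom.2 (Complex.continuous_ofReal.comp hf)
  let F : C(AddCircle (2 * π), ℂ) := ⟨hperC.lift, hc⟩
  have hF : ∀ y : ℝ, F (y : AddCircle (2 * π)) = (f y : ℂ) := fun y => rfl
  have hcoef : ∀ n : ℤ, fourierCoeff F n = 0 := by
    intro n
    rw [fourierCoeff_eq_intervalIntegral (T := 2 * π) (F : AddCircle (2 * π) → ℂ) n 0]
    have e : ∀ y : ℝ, fourier (T := 2 * π) (-n) (y : AddCircle (2 * π))
        • F (y : AddCircle (2 * π)) = ((f y * cos (n * y + 0) : ℝ) : ℂ)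
          - Complex.I * ((f y * cos (n * y + -(π / 2)) : ℝ) : ℂ) := by
      intro y
      have e1 : (2 * (π : ℂ) * Complex.I * ((-n : ℤ) : ℂ) * (y : ℂ) / ((2 * π : ℝ) : ℂ))
          = ((-(n * y) : ℝ) : ℂ) * Complex.I := by
        have : (π : ℂ) ≠ 0 := by exact_mod_cast pi_ne_zero
        push_cast
        field_simp
      rw [fourier_coe_apply, hF, e1, Complex.exp_mul_I, ← Complex.ofReal_cos,
        ← Complex.ofReal_sin, cos_neg, sin_neg, add_zero, ← sub_eq_add_neg, cos_sub_pi_div_two]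
      push_cast
      rw [smul_eq_mul]
      ring
    simp only [e, zero_add]
    have i1 : IntervalIntegrable (fun y : ℝ => ((f y * cos (n * y + 0) : ℝ) : ℂ))
        MeasureTheory.volume 0 (2 * π) := by
      apply Continuous.intervalIntegrable; fun_prop
    have i2 : IntervalIntegrable (fun y : ℝ => Complex.I * ((f y * cos (n * y + -(π / 2)) : ℝ) : ℂ))
        MeasureTheory.volume 0 (2 * π) := by
      apply Continuous.intervalIntegrable; fun_prop
    rw [intervalIntegral.integral_sub i1 i2, intervalIntegral.integral_const_mul,
      intervalIntegral.integral_ofReal, intervalIntegral.integral_ofReal, h, h]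
    simp
  have hs := has_pointwise_sum_fourier_series_of_summable (f := F)
    (by rw [show fourierCoeff F = fun _ => 0 from funext hcoef]; exact summable_zero)
    (x : AddCircle (2 * π))
  simp only [hcoef, zero_smul] at hs
  have := hs.unique hasSum_zero
  rw [hF] at this
  exact_mod_cast this

/-! ### Averages over the circles -/

theorem continuousOn_circleIntegral {T : ℝ} {A : ℝ × ℝ → ℝ} (hT : 0 < T)
    (hA : ContinuousOn A (strip T)) :
    ContinuousOn (fun t => ∫ θ in (0 : ℝ)..(2 * π), A (t, θ)) (Icc (-T) T) := by
  have hle : -T ≤ T := by linarith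
  let A' : ℝ → ℝ → ℝ := fun t θ => A ((projIcc (-T) T hle t : ℝ), θ)
  have hA' : Continuous A'.uncurry := by
    refine hA.comp_continuous (f := fun p : ℝ × ℝ => ((projIcc (-T) T hle p.1 : ℝ), p.2)) ?_
      fun p => mem_strip.2 (projIcc (-T) T hle p.1).2
    exact (continuous_subtype_val.comp (continuous_projIcc.comp continuous_fst)).prodMk
      continuous_snd
  have h := intervalIntegral.continuous_parametric_intervalIntegral_of_continuous'
    (μ := MeasureTheory.volume) hA' 0 (2 * π)
  refine h.continuousOn.congr fun t ht => ?_
  simp only [A', projIcc_of_mem hle ht]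

theorem continuous_slice {T t : ℝ} {A : ℝ × ℝ → ℝ} (hA : ContinuousOn A (strip T))
    (ht : t ∈ Icc (-T) T) : Continuous fun θ => A (t, θ) :=
  hA.comp_continuous (by fun_prop) fun _ => mem_strip.2 ht

/-- The average of `A` over the circles `t = const` may be differentiated up to a total
`θ`-derivative of a periodic function `W`. -/
theorem hasDerivAt_circleIntegral {T : ℝ} (hT : 0 < T) {A B : ℝ × ℝ → ℝ} {W : ℝ → ℝ → ℝ}
    (hA : ContDiffOn ℝ ∞ A (strip T)) (hB : ContinuousOn B (strip T)) {t : ℝ}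
    (ht : t ∈ Ioo (-T) T)
    (hW : ∀ θ, HasDerivAt (W t) (partialT T A (t, θ) - B (t, θ)) θ)
    (hper : W t (2 * π) = W t 0) :
    HasDerivAt (fun t => ∫ θ in (0 : ℝ)..(2 * π), A (t, θ))
      (∫ θ in (0 : ℝ)..(2 * π), B (t, θ)) t := by
  have hA' := (contDiffOn_partial hT hA et).continuousOn
  have htc := Ioo_subset_Icc_self ht
  have hK : IsCompact (Icc (-T) T ×ˢ Icc (0 : ℝ) (2 * π)) := isCompact_Icc.prod isCompact_Icc
  obtain ⟨C, hC⟩ := hK.exists_bound_of_continuousOn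
    (hA'.mono fun p hp => mem_strip.2 hp.1)
  have hs : Ioo (-T) T ∈ nhds t := isOpen_Ioo.mem_nhds ht
  have key := (intervalIntegral.hasDerivAt_integral_of_dominated_loc_of_deriv_le
    (μ := MeasureTheory.volume) (a := 0) (b := 2 * π) (F := fun t θ => A (t, θ))
    (F' := fun t θ => partialT T A (t, θ)) (bound := fun _ => C) hs
    (Filter.eventually_of_mem hs fun r hr =>
      (continuous_slice hA.continuousOn (Ioo_subset_Icc_self hr)).aestronglyMeasurable)
    ((continuous_slice hA.continuousOn htc).intervalIntegrable _ _)
    (continuous_slice hA' htc).aestronglyMeasurable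
    (Filter.Eventually.of_forall fun θ hθ r hr => hC (r, θ) ⟨Ioo_subset_Icc_self hr, by
      rw [uIoc_of_le two_pi_pos.le] at hθ
      exact Ioc_subset_Icc_self hθ⟩)
    intervalIntegrable_const
    (Filter.Eventually.of_forall fun θ _ r hr =>
      (hasDerivWithinAt_partialT (differentiableWithinAt_of_contDiffOn hA
        (mem_strip.2 (Ioo_subset_Icc_self hr)))).hasDerivAt (Icc_mem_nhds hr.1 hr.2))).2
  have i1 := (continuous_slice hA' htc).intervalIntegrable (μ := MeasureTheory.volume) 0 (2 * π)
  have i2 := (continuous_slice hB htc).intervalIntegrable (μ := MeasureTheory.volume) 0 (2 * π)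
  have h0 := intervalIntegral.integral_eq_sub_of_hasDerivAt (fun θ _ => hW θ) (i1.sub i2)
  rw [intervalIntegral.integral_sub i1 i2, hper, sub_self] at h0
  rwa [sub_eq_zero.1 h0] at key

/-! ### The system satisfied by the mode coefficients -/

theorem eq_of_hasDerivAt_zero {T : ℝ} {f : ℝ → ℝ} (hc : ContinuousOn f (Icc (-T) T))
    (hd : ∀ t ∈ Ioo (-T) T, HasDerivAt f 0 t) {t r : ℝ} (ht : t ∈ Icc (-T) T)
    (hr : r ∈ Icc (-T) T) : f t = f r := by
  wlog h : t < r generalizing t r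
  · rcases (not_lt.1 h).eq_or_lt with h | h
    · rw [h]
    · exact (this hr ht h).symm
  obtain ⟨x, -, hx⟩ := exists_hasDerivAt_eq_slope f (fun _ => 0) h
    (hc.mono (Icc_subset_Icc ht.1 hr.2))
    fun x hx => hd x ⟨ht.1.trans_lt hx.1, hx.2.trans_le hr.2⟩
  rw [eq_div_iff (sub_pos.2 h).ne'] at hx
  linarith

/-- The least positive eigenvalue of the flat band `[-S, S] × ℝ / ∼`. -/
def flatSigma (S : ℝ) : ℝ := min (cosh S / sinh S) (2 * tanh (2 * S))

theorem flatSigma_pos {S : ℝ} (hS : 0 < S) : 0 < flatSigma S := by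
  have h1 := Real.sinh_pos_iff.2 hS
  have h2 : 0 < tanh (2 * S) := by
    rw [← tanh_zero]
    exact tanh_lt_tanh (by linarith)
  exact lt_min (div_pos (cosh_pos S) h1) (by linarith)

theorem cosh_intCast_natAbs_mul (n : ℤ) (S : ℝ) : cosh (n * S) = cosh (n.natAbs * S) := by
  rw [Nat.cast_natAbs, Int.cast_abs]
  rcases abs_choice (n : ℝ) with h | h <;> rw [h]
  rw [neg_mul, cosh_neg]

theorem mul_sinh_intCast_natAbs_mul (n : ℤ) (S : ℝ) :
    n * sinh (n * S) = n.natAbs * sinh (n.natAbs * S) := by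
  rw [Nat.cast_natAbs, Int.cast_abs]
  rcases abs_choice (n : ℝ) with h | h <;> rw [h]
  rw [neg_mul (n : ℝ) S, sinh_neg, neg_mul_neg]

/-- The eigenvalues `n coth nS` of the odd modes are at least that of `n = 1`. -/
theorem flatSigma_le_of_odd {S μ : ℝ} (hS : 0 < S) {n : ℤ} (hn : Odd n)
    (h : n * cosh (n * S) = μ * sinh (n * S)) : flatSigma S ≤ μ := by
  have hn0 : 0 < n.natAbs := Int.natAbs_pos.2 fun h0 => by simp [h0] at hn
  set m := n.natAbs with hm
  have h1 : m * cosh (m * S) = μ * sinh (m * S) := by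
    have e1 := cosh_intCast_natAbs_mul n S
    have e2 := mul_sinh_intCast_natAbs_mul n S
    have e3 : (m : ℝ) ^ 2 = n ^ 2 := by
      rw [hm, Nat.cast_natAbs, Int.cast_abs, sq_abs]
    have hm0 : (m : ℝ) ≠ 0 := by exact_mod_cast hn0.ne'
    apply mul_left_cancel₀ hm0
    rw [← hm] at e1 e2
    linear_combination (cosh (m * S)) * e3 - n ^ 2 * e1 + n * h + μ * e2
  have h2 := sinh_mul_cosh_le hS m
  have hs : 0 < sinh (m * S) := Real.sinh_pos_iff.2 (by positivity)
  refine (min_le_left _ _).trans ?_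
  rw [div_le_iff₀ (Real.sinh_pos_iff.2 hS)]
  rw [h1] at h2
  nlinarith

/-- The eigenvalues `n tanh nS` of the nonconstant even modes are at least that of `n = 2`. -/
theorem flatSigma_le_of_even {S μ : ℝ} (hS : 0 < S) {n : ℤ} (hn : Even n) (hn0 : n ≠ 0)
    (h : μ * cosh (n * S) = n * sinh (n * S)) : flatSigma S ≤ μ := by
  have hm2 : (2 : ℝ) ≤ n.natAbs := by
    have : 2 ≤ n.natAbs := by
      obtain ⟨k, rfl⟩ := hn
      omega
    exact_mod_cast this
  rw [cosh_intCast_natAbs_mul, mul_sinh_intCast_natAbs_mul] at h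
  refine (min_le_right _ _).trans ?_
  set m : ℝ := (n.natAbs : ℝ)
  have hμ : μ = m * tanh (m * S) := by
    rw [tanh_eq_sinh_div_cosh, mul_div_assoc', eq_div_iff (cosh_pos _).ne', h]
  have h2 : tanh (2 * S) ≤ tanh (m * S) := by
    rcases hm2.eq_or_lt with h | h
    · rw [h]
    · exact (tanh_lt_tanh (mul_lt_mul_of_pos_right h hS)).le
  have h3 : 0 ≤ tanh (2 * S) := by
    rw [← tanh_zero]
    exact (tanh_lt_tanh (by linarith)).le
  rw [hμ]
  nlinarith

/-- The system `z' = s' q`, `q' = n² s' z` has the first integrals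
`q cosh ns - n z sinh ns` and `n z cosh ns - q sinh ns`.  With the parity of `z` and the boundary
condition `q = μ z`, they leave only the trivial solution when `μ` is below the first eigenvalue of
the flat band. -/
theorem mode_coefficient_eq_zero {T μ : ℝ} (hT : 0 < T) {z q s κ : ℝ → ℝ} (n : ℤ)
    (hzc : ContinuousOn z (Icc (-T) T)) (hqc : ContinuousOn q (Icc (-T) T))
    (hsc : ContinuousOn s (Icc (-T) T))
    (hz : ∀ t ∈ Ioo (-T) T, HasDerivAt z (κ t * q t) t)
    (hq : ∀ t ∈ Ioo (-T) T, HasDerivAt q (n ^ 2 * (κ t * z t)) t)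
    (hs : ∀ t ∈ Ioo (-T) T, HasDerivAt s (κ t) t)
    (hκ : κ 0 ≠ 0) (hs0 : s 0 = 0) (hsT : 0 < s T)
    (hodd : Odd n → z 0 = 0) (heven : Even n → ∀ t ∈ Icc (-T) T, z (-t) = z t)
    (hb : q T = μ * z T) (hμ0 : 0 < μ) (hμ : μ < flatSigma (s T)) {t : ℝ}
    (ht : t ∈ Icc (-T) T) : z t = 0 := by
  have h0 : (0 : ℝ) ∈ Icc (-T) T := ⟨by linarith, hT.le⟩
  have h0' : (0 : ℝ) ∈ Ioo (-T) T := ⟨by linarith, hT⟩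
  have hTm : T ∈ Icc (-T) T := ⟨by linarith, le_rfl⟩
  have I1 : ∀ r ∈ Icc (-T) T, q r * cosh (n * s r) - n * z r * sinh (n * s r) = q 0 := by
    intro r hr
    have := eq_of_hasDerivAt_zero
      (f := fun r => q r * cosh (n * s r) - n * z r * sinh (n * s r)) (by fun_prop)
      (fun r hr => (((hq r hr).mul ((hs r hr).const_mul (n : ℝ)).cosh).sub
        (((hz r hr).const_mul (n : ℝ)).mul ((hs r hr).const_mul (n : ℝ)).sinh)).congr_deriv
        (by ring)) hr h0
    simpa [hs0] using this
  have I2 : ∀ r ∈ Icc (-T) T, n * z r * cosh (n * s r) - q r * sinh (n * s r) = n * z 0 := by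
    intro r hr
    have := eq_of_hasDerivAt_zero
      (f := fun r => n * z r * cosh (n * s r) - q r * sinh (n * s r)) (by fun_prop)
      (fun r hr => ((((hz r hr).const_mul (n : ℝ)).mul ((hs r hr).const_mul (n : ℝ)).cosh).sub
        ((hq r hr).mul ((hs r hr).const_mul (n : ℝ)).sinh)).congr_deriv
        (by ring)) hr h0
    simpa [hs0] using this
  -- If both initial values vanish, the first integrals determine `z = 0`.
  have hfin : n ≠ 0 → q 0 = 0 → z 0 = 0 → z t = 0 := by
    intro hn h1 h2
    have e1 := I1 t ht
    have e2 := I2 t ht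
    have hn' : (n : ℝ) ≠ 0 := by exact_mod_cast hn
    rw [h1] at e1
    rw [h2] at e2
    have : n * z t = 0 := by
      linear_combination sinh (n * s t) * e1 + cosh (n * s t) * e2
        - (n * z t) * cosh_sq_sub_sinh_sq (n * s t)
    exact (mul_eq_zero.1 this).resolve_left hn'
  rcases Int.even_or_odd n with hn | hn
  · -- An even function has vanishing derivative at `0`.
    have hz0 : q 0 = 0 := by
      have hneg : HasDerivAt (fun r : ℝ => -r) (-1) 0 := (hasDerivAt_id 0).neg
      have hz' : HasDerivAt z (κ 0 * q 0) (-0) := by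
        rw [neg_zero]; exact hz 0 h0'
      have e2 := (hz'.comp 0 hneg).congr_of_eventuallyEq
        (Filter.eventually_of_mem (Icc_mem_nhds h0'.1 h0'.2)
          fun r hr => (heven hn r hr).symm)
      have := e2.unique (hz 0 h0')
      have h2 : κ 0 * q 0 = 0 := by linarith
      exact (mul_eq_zero.1 h2).resolve_left hκ
    by_cases hn0 : n = 0
    · have hq0 : ∀ r ∈ Icc (-T) T, q r = 0 := fun r hr => by
        simpa [hn0, hz0] using I1 r hr
      have hzT : z T = 0 := by
        rw [hq0 T hTm] at hb
        exact (mul_eq_zero.1 hb.symm).resolve_left hμ0.ne'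
      rw [← hzT]
      exact eq_of_hasDerivAt_zero hzc (fun r hr => (hz r hr).congr_deriv (by
        rw [hq0 r (Ioo_subset_Icc_self hr), mul_zero])) ht hTm
    · have e1 := I1 T hTm
      have e2 := I2 T hTm
      rw [hz0, hb] at e1
      have hzT : z T = 0 := by
        by_contra hne
        refine hμ.not_ge (flatSigma_le_of_even hsT hn hn0 ?_)
        apply mul_left_cancel₀ hne
        linarith
      rw [hb, hzT] at e2
      have hn' : (n : ℝ) ≠ 0 := by exact_mod_cast hn0
      exact hfin hn0 hz0 ((mul_eq_zero.1 (by linarith : (n : ℝ) * z 0 = 0)).resolve_left hn')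
  · have hn0 : n ≠ 0 := fun h0 => by simp [h0] at hn
    have e1 := I1 T hTm
    have e2 := I2 T hTm
    rw [hodd hn, hb] at e2
    have hzT : z T = 0 := by
      by_contra hne
      refine hμ.not_ge (flatSigma_le_of_odd hsT hn ?_)
      apply mul_left_cancel₀ hne
      linarith
    rw [hb, hzT] at e1
    exact hfin hn0 (by linarith) (hodd hn)

/-! ### The least positive Steklov eigenvalue -/

theorem partialT_mul {T t θ : ℝ} (hT : 0 < T) {f h : ℝ × ℝ → ℝ} (ht : t ∈ Icc (-T) T)
    (hf : ContDiffOn ℝ ∞ f (strip T)) (hh : ContDiffOn ℝ ∞ h (strip T)) :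
    partialT T (fun p => f p * h p) (t, θ)
      = partialT T f (t, θ) * h (t, θ) + f (t, θ) * partialT T h (t, θ) := by
  have h1 := differentiableWithinAt_of_contDiffOn hf (mem_strip.2 ht : (t, θ) ∈ strip T)
  have h2 := differentiableWithinAt_of_contDiffOn hh (mem_strip.2 ht : (t, θ) ∈ strip T)
  exact partialT_eq hT ht (h1.mul h2)
    ((hasDerivWithinAt_partialT h1).mul (hasDerivWithinAt_partialT h2))

theorem deck_deck (t θ : ℝ) : deck (deck (t, θ)) = (t, θ + 2 * π) := by
  ext <;> simp [deck]
  ring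

theorem eq_add_two_pi_of_deck {T t : ℝ} {f : ℝ × ℝ → ℝ}
    (hf : ∀ p ∈ strip T, f (deck p) = f p) (ht : t ∈ Icc (-T) T) (θ : ℝ) :
    f (t, θ + 2 * π) = f (t, θ) := by
  have hp : (t, θ) ∈ strip T := mem_strip.2 ht
  rw [← deck_deck, hf _ (deck_mem_strip hp), hf _ hp]

namespace Metric

variable {T : ℝ} {g : Metric T}

theorem F_add_two_pi (g : Metric T) {t : ℝ} (ht : t ∈ Icc (-T) T) (θ : ℝ) :
    g.F (t, θ + 2 * π) = g.F (t, θ) := by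
  have hp : (t, θ) ∈ strip T := mem_strip.2 ht
  rw [← deck_deck, g.F_deck _ (deck_mem_strip hp), g.F_deck _ hp, neg_neg]

theorem fluxθ_add_two_pi (g : Metric T) (hT : 0 < T) {u : ℝ × ℝ → ℝ}
    (hu : ContDiffOn ℝ ∞ u (strip T)) (hdeck : ∀ p ∈ strip T, u (deck p) = u p) {t : ℝ}
    (ht : t ∈ Icc (-T) T) (θ : ℝ) : g.fluxθ u (t, θ + 2 * π) = g.fluxθ u (t, θ) := by
  have hp : (t, θ) ∈ strip T := mem_strip.2 ht
  have hp' : (t, θ + 2 * π) ∈ strip T := mem_strip.2 ht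
  have d1 : partialT T u (t, θ + 2 * π) = partialT T u (t, θ) :=
    partialT_eq hT ht (differentiableWithinAt_of_contDiffOn hu hp')
      ((hasDerivWithinAt_partialT (differentiableWithinAt_of_contDiffOn hu hp)).congr
        (fun r hr => eq_add_two_pi_of_deck hdeck hr θ) (eq_add_two_pi_of_deck hdeck ht θ))
  have d2 : partialθ T u (t, θ + 2 * π) = partialθ T u (t, θ) := by
    refine (partialθ_eq ht (differentiableWithinAt_of_contDiffOn hu hp) ?_).symm
    have h1 := (hasDerivAt_partialθ ht
      (differentiableWithinAt_of_contDiffOn hu hp')).comp_add_const θ (2 * π)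
    exact h1.congr_of_eventuallyEq
      (Filter.Eventually.of_forall fun r => (eq_add_two_pi_of_deck hdeck ht r).symm)
  simp only [fluxθ]
  rw [d1, d2, eq_add_two_pi_of_deck g.E_deck ht, g.F_add_two_pi ht,
    eq_add_two_pi_of_deck (fun p hp => g.density_deck hp) ht]

theorem IsSteklovEigenfunction.fluxT_boundary {u : ℝ × ℝ → ℝ} {σ : ℝ}
    (hu : g.IsSteklovEigenfunction σ u) (hT : 0 < T) (θ : ℝ) :
    g.fluxT u (T, θ) = σ * √(g.G (T, θ)) * u (T, θ) := by
  have hp : (T, θ) ∈ strip T := mem_strip.2 ⟨by linarith, le_rfl⟩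
  have hv := g.isOutwardConormal_of_pos hp hT
  have h1 := hu.boundary (T, θ) (abs_of_pos hT) _ hv
  have hr := Real.sqrt_pos.2 (g.G_pos hp)
  rw [hv.fderivWithin_eq hp, sign_pos hT, SignType.coe_one, one_mul, div_eq_iff hr.ne'] at h1
  rw [h1]; ring

namespace IsIsothermal

variable {s a : ℝ → ℝ}

theorem contDiffOn_testMode (H : g.IsIsothermal s a) (k c : ℝ) :
    ContDiffOn ℝ ∞ (mode s a (fun _ => 1) k c) (strip T) :=
  H.contDiffOn_mode contDiff_const

theorem density_div_G_eq (H : g.IsIsothermal s a) (hT : 0 < T) {t : ℝ} (ht : t ∈ Icc (-T) T)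
    (θ θ' : ℝ) : g.density (t, θ) / g.G (t, θ) = g.density (t, θ') / g.G (t, θ') :=
  (uniqueDiffOn_Icc (by linarith : -T < T) t ht).eq_deriv _
    (H.hasDeriv_s t θ ht) (H.hasDeriv_s t θ' ht)

theorem F_div_G_eq (H : g.IsIsothermal s a) (hT : 0 < T) {t : ℝ} (ht : t ∈ Icc (-T) T)
    (θ θ' : ℝ) : g.F (t, θ) / g.G (t, θ) = g.F (t, θ') / g.G (t, θ') :=
  (uniqueDiffOn_Icc (by linarith : -T < T) t ht).eq_deriv _
    (H.hasDeriv_a t θ ht) (H.hasDeriv_a t θ' ht)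

/-- The coefficient of `u` along the mode `cos(k(θ + a) + c)` has derivative `s'` times the
corresponding coefficient of the flux. -/
theorem hasDerivAt_coefficient (H : g.IsIsothermal s a) (hT : 0 < T) {u : ℝ × ℝ → ℝ}
    (hu : ContDiffOn ℝ ∞ u (strip T)) (hdeck : ∀ p ∈ strip T, u (deck p) = u p) (k : ℤ) (c : ℝ)
    {t : ℝ} (ht : t ∈ Ioo (-T) T) :
    HasDerivAt (fun t => ∫ θ in (0 : ℝ)..(2 * π), u (t, θ) * mode s a (fun _ => 1) k c (t, θ))
      (g.density (t, 0) / g.G (t, 0) *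
        ∫ θ in (0 : ℝ)..(2 * π), g.fluxT u (t, θ) * mode s a (fun _ => 1) k c (t, θ)) t := by
  have hχ := H.contDiffOn_testMode k c
  have htc := Ioo_subset_Icc_self ht
  have hB : ContinuousOn (fun p => g.density p / g.G p *
      (g.fluxT u p * mode s a (fun _ => 1) k c p)) (strip T) :=
    ((g.contDiffOn_density.div g.smooth_G fun p hp => (g.G_pos hp).ne').mul
      ((g.contDiffOn_fluxT hT hu).mul hχ)).continuousOn
  have key := hasDerivAt_circleIntegral hT (hu.mul hχ) hB ht
    -- `∂χ/∂t = (F/G) ∂χ/∂θ`, and `∂u/∂t = (D/G) fluxT + (F/G) ∂u/∂θ`.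
    (W := fun t θ => g.F (t, 0) / g.G (t, 0) * (u (t, θ) * mode s a (fun _ => 1) k c (t, θ)))
    (fun θ => ?_) ?_
  · refine key.congr_deriv ?_
    rw [← intervalIntegral.integral_const_mul]
    refine intervalIntegral.integral_congr fun θ _ => ?_
    simp only [H.density_div_G_eq hT htc θ 0]
  · have hp : (t, θ) ∈ strip T := mem_strip.2 htc
    refine (((hasDerivAt_partialθ htc (differentiableWithinAt_of_contDiffOn hu hp)).mul
      (hasDerivAt_partialθ htc (differentiableWithinAt_of_contDiffOn hχ hp))).const_mul
      _).congr_deriv ?_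
    rw [partialT_mul hT htc hu hχ, H.partialT_mode hT contDiff_const
      (fun x => hasDerivAt_const x (1 : ℝ)) htc, H.partialθ_mode contDiff_const htc,
      H.F_div_G_eq hT htc 0 θ, fluxT]
    have hG := (g.G_pos hp).ne'
    have hD := (g.density_pos hp).ne'
    field_simp
    ring
  · have h1 := eq_add_two_pi_of_deck hdeck htc 0
    have h2 : mode s a (fun _ => 1) k c (t, 2 * π) = mode s a (fun _ => 1) k c (t, 0) := by
      simp only [mode]
      rw [show (k : ℝ) * (2 * π + a t) + c = (k * (0 + a t) + c) + k * (2 * π) by ring,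
        cos_add_int_mul_two_pi]
    rw [zero_add] at h1
    simp only [h1, h2]

/-- For a harmonic function, the coefficient of the flux along a mode has derivative `k² s'` times
the coefficient of the function. -/
theorem hasDerivAt_flux_coefficient (H : g.IsIsothermal s a) (hT : 0 < T) {u : ℝ × ℝ → ℝ}
    (hu : ContDiffOn ℝ ∞ u (strip T)) (hdeck : ∀ p ∈ strip T, u (deck p) = u p)
    (hharm : ∀ p ∈ strip T, g.laplacian u p = 0) (k : ℤ) (c : ℝ)
    {t : ℝ} (ht : t ∈ Ioo (-T) T) :
    HasDerivAt
      (fun t => ∫ θ in (0 : ℝ)..(2 * π), g.fluxT u (t, θ) * mode s a (fun _ => 1) k c (t, θ))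
      (k ^ 2 * (g.density (t, 0) / g.G (t, 0) *
        ∫ θ in (0 : ℝ)..(2 * π), u (t, θ) * mode s a (fun _ => 1) k c (t, θ))) t := by
  have hχ := H.contDiffOn_testMode k c
  have hP := g.contDiffOn_fluxT hT hu
  have hQ := g.contDiffOn_fluxθ hT hu
  have htc := Ioo_subset_Icc_self ht
  have hB : ContinuousOn (fun p => k ^ 2 * (g.density p / g.G p *
      (u p * mode s a (fun _ => 1) k c p))) (strip T) :=
    (contDiffOn_const.mul ((g.contDiffOn_density.div g.smooth_G fun p hp => (g.G_pos hp).ne').mul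
      (hu.mul hχ))).continuousOn
  have key := hasDerivAt_circleIntegral hT (hP.mul hχ) hB ht
    -- By harmonicity `∂/∂t fluxT = -∂/∂θ fluxθ`; integrate by parts in `θ` twice.
    (W := fun t θ => g.density (t, 0) / g.G (t, 0) *
        (u (t, θ) * -(k * sin (k * (θ + a t) + c)))
      - g.fluxθ u (t, θ) * mode s a (fun _ => 1) k c (t, θ))
    (fun θ => ?_) ?_
  · refine key.congr_deriv ?_
    rw [← mul_assoc, ← intervalIntegral.integral_const_mul]
    refine intervalIntegral.integral_congr fun θ _ => ?_
    simp only [H.density_div_G_eq hT htc θ 0, mul_assoc]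
  · have hp : (t, θ) ∈ strip T := mem_strip.2 htc
    have hsin : HasDerivAt (fun r : ℝ => -(k * sin (k * (r + a t) + c)))
        (-(k * (cos (k * (θ + a t) + c) * k))) θ :=
      ((((((hasDerivAt_id θ).add_const (a t)).const_mul (k : ℝ)).add_const c).sin.const_mul
        (k : ℝ)).neg).congr_deriv (by simp)
    refine ((((hasDerivAt_partialθ htc (differentiableWithinAt_of_contDiffOn hu hp)).mul
      hsin).const_mul _).sub
      ((hasDerivAt_partialθ htc (differentiableWithinAt_of_contDiffOn hQ hp)).mul
      (hasDerivAt_partialθ htc (differentiableWithinAt_of_contDiffOn hχ hp)))).congr_deriv ?_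
    have hlap := hharm _ hp
    rw [laplacian_eq] at hlap
    have hG := (g.G_pos hp).ne'
    have hD := (g.density_pos hp).ne'
    have hlap' : partialθ T (g.fluxθ u) (t, θ) = -partialT T (g.fluxT u) (t, θ) := by
      have := (mul_eq_zero.1 hlap).resolve_left (inv_ne_zero hD)
      linarith
    have hE := g.E_mul_G hp
    rw [partialT_mul hT htc hP hχ, H.partialT_mode hT contDiff_const
      (fun x => hasDerivAt_const x (1 : ℝ)) htc, H.partialθ_mode contDiff_const htc, hlap',
      H.density_div_G_eq hT htc 0 θ]
    have hPQ : g.fluxT u (t, θ) * (g.F (t, θ) / g.G (t, θ)) + g.fluxθ u (t, θ)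
        = g.density (t, θ) / g.G (t, θ) * partialθ T u (t, θ) := by
      simp only [fluxT, fluxθ]
      field_simp
      linear_combination partialθ T u (t, θ) * hE
    simp only [mode]
    linear_combination (k * sin (k * (θ + a t) + c)) * hPQ
  · have h1 := eq_add_two_pi_of_deck hdeck htc 0
    have h3 := g.fluxθ_add_two_pi hT hu hdeck htc 0
    have e : (k : ℝ) * (2 * π + a t) + c = (k * (0 + a t) + c) + k * (2 * π) := by ring
    have h2 : mode s a (fun _ => 1) k c (t, 2 * π) = mode s a (fun _ => 1) k c (t, 0) := by
      simp only [mode]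
      rw [e, cos_add_int_mul_two_pi]
    rw [zero_add] at h1 h3
    simp only [h1, h2, h3, e, sin_add_int_mul_two_pi]

/-- The glide reflection acts on the coefficient of degree `k` by the sign `(-1)^k`. -/
theorem coefficient_neg (H : g.IsIsothermal s a) {u : ℝ × ℝ → ℝ}
    (hdeck : ∀ p ∈ strip T, u (deck p) = u p) (k : ℤ) (c : ℝ) {t : ℝ} (ht : t ∈ Icc (-T) T) :
    ∫ θ in (0 : ℝ)..(2 * π), u (-t, θ) * mode s a (fun _ => 1) k c (-t, θ)
      = (-1) ^ k * ∫ θ in (0 : ℝ)..(2 * π), u (t, θ) * mode s a (fun _ => 1) k c (t, θ) := by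
  have ht' : -t ∈ Icc (-T) T := ⟨by linarith [ht.2], by linarith [ht.1]⟩
  set f : ℝ → ℝ := fun θ => u (-t, θ) * mode s a (fun _ => 1) k c (-t, θ) with hf
  have hper : Function.Periodic f (2 * π) := by
    intro θ
    simp only [hf, mode]
    rw [eq_add_two_pi_of_deck hdeck ht' θ,
      show (k : ℝ) * (θ + 2 * π + a (-t)) + c = (k * (θ + a (-t)) + c) + k * (2 * π) by ring,
      cos_add_int_mul_two_pi]
  have h1 := hper.intervalIntegral_add_eq 0 π
  have h2 := intervalIntegral.integral_comp_add_right (a := 0) (b := 2 * π) f π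
  rw [zero_add] at h1 h2
  rw [h1, add_comm π (2 * π), ← h2, ← intervalIntegral.integral_const_mul]
  refine intervalIntegral.integral_congr fun θ _ => ?_
  have h3 : u (-t, θ + π) = u (t, θ) := hdeck (t, θ) (mem_strip.2 ht)
  simp only [hf, mode, h3, H.a_neg]
  rw [show (k : ℝ) * (θ + π + a t) + c = (k * (θ + a t) + c) + k * π by ring,
    cos_add_int_mul_pi]
  ring

/-- Below the flat eigenvalue all mode coefficients of an eigenfunction vanish, so there is no
eigenfunction. -/
theorem flatSigma_le (H : g.IsIsothermal s a) (hT : 0 < T) {u : ℝ × ℝ → ℝ} {σ : ℝ} (hσ : 0 < σ)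
    (hu : g.IsSteklovEigenfunction σ u) : flatSigma (s T) ≤ σ * √(g.G (T, 0)) := by
  by_contra! hlt
  -- The multiplier `σ √G` relates `fluxT` to `u` on the boundary.
  have hTm : (T, (0 : ℝ)) ∈ strip T := mem_strip.2 ⟨by linarith, le_rfl⟩
  have hμ0 : 0 < σ * √(g.G (T, 0)) := mul_pos hσ (Real.sqrt_pos.2 (g.G_pos hTm))
  have h0 : (0 : ℝ) ∈ Icc (-T) T := ⟨by linarith, hT.le⟩
  have hcoef : ∀ (n : ℤ) (c t : ℝ), t ∈ Icc (-T) T →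
      ∫ θ in (0 : ℝ)..(2 * π), u (t, θ) * mode s a (fun _ => 1) n c (t, θ) = 0 := by
    intro n c t ht
    have hχ := H.contDiffOn_testMode n c
    refine mode_coefficient_eq_zero hT (κ := fun t => g.density (t, 0) / g.G (t, 0)) (s := s)
      (z := fun t => ∫ θ in (0 : ℝ)..(2 * π), u (t, θ) * mode s a (fun _ => 1) n c (t, θ))
      (q := fun t => ∫ θ in (0 : ℝ)..(2 * π), g.fluxT u (t, θ) * mode s a (fun _ => 1) n c (t, θ))
      n (continuousOn_circleIntegral hT (hu.smooth.mul hχ).continuousOn)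
      (continuousOn_circleIntegral hT ((g.contDiffOn_fluxT hT hu.smooth).mul hχ).continuousOn)
      H.contDiffOn_s.continuousOn
      (fun r hr => H.hasDerivAt_coefficient hT hu.smooth hu.deck_eq n c hr)
      (fun r hr => H.hasDerivAt_flux_coefficient hT hu.smooth hu.deck_eq hu.harmonic n c hr)
      (fun r hr => (H.hasDeriv_s r 0 (Ioo_subset_Icc_self hr)).hasDerivAt
        (Icc_mem_nhds hr.1 hr.2))
      (div_pos (g.density_pos (mem_strip.2 h0)) (g.G_pos (mem_strip.2 h0))).ne' H.s_zero
      (H.s_T_pos hT) (fun hn => ?_) (fun hn r hr => ?_) ?_ hμ0 hlt ht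
    · have := H.coefficient_neg hu.deck_eq n c h0
      rw [hn.neg_one_zpow, neg_zero] at this
      linarith
    · have := H.coefficient_neg hu.deck_eq n c hr
      rwa [hn.neg_one_zpow, one_mul] at this
    · rw [← intervalIntegral.integral_const_mul]
      refine intervalIntegral.integral_congr fun θ _ => ?_
      simp only [hu.fluxT_boundary hT θ, H.G_boundary θ, mul_assoc]
  obtain ⟨⟨t, θ⟩, hp, hne⟩ := hu.ne_zero
  have ht := mem_strip.1 hp
  -- At fixed `t`, absorbing the shift `a t` in the phase gives all trigonometric coefficients.
  refine hne (eq_zero_of_forall_integral_mul_cos (f := fun θ => u (t, θ))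
    (continuous_slice hu.smooth.continuousOn ht)
    (fun x => eq_add_two_pi_of_deck hu.deck_eq ht x) (fun n c => ?_) θ)
  refine Eq.trans ?_ (hcoef n (c - n * a t) t ht)
  refine intervalIntegral.integral_congr fun x _ => ?_
  simp only [mode, one_mul]
  ring_nf

theorem isLeast_positiveSteklovSpectrum (H : g.IsIsothermal s a) (hT : 0 < T) :
    IsLeast g.positiveSteklovSpectrum (flatSigma (s T) / √(g.G (T, 0))) := by
  have hTm : (T, (0 : ℝ)) ∈ strip T := mem_strip.2 ⟨by linarith, le_rfl⟩
  have hr := Real.sqrt_pos.2 (g.G_pos hTm)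
  refine ⟨⟨div_pos (flatSigma_pos (H.s_T_pos hT)) hr, ?_⟩, fun σ ⟨hσ, u, hu⟩ => ?_⟩
  · rcases min_choice (cosh (s T) / sinh (s T)) (2 * tanh (2 * s T)) with h | h
    · rw [flatSigma, h]
      exact ⟨_, H.isSteklovEigenfunction_sinh hT one_ne_zero 0⟩
    · rw [flatSigma, h]
      exact ⟨_, H.isSteklovEigenfunction_cosh hT one_ne_zero 0⟩
  · rw [div_le_iff₀ hr]
    exact H.flatSigma_le hT hσ hu

theorem sigmaOne_eq (H : g.IsIsothermal s a) (hT : 0 < T) :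
    g.sigmaOne = flatSigma (s T) / √(g.G (T, 0)) :=
  (H.isLeast_positiveSteklovSpectrum hT).csInf_eq

theorem isLeast_sigmaOne (H : g.IsIsothermal s a) (hT : 0 < T) :
    IsLeast g.positiveSteklovSpectrum g.sigmaOne := by
  rw [H.sigmaOne_eq hT]
  exact H.isLeast_positiveSteklovSpectrum hT

theorem sigmaOne_mul_boundaryLength (H : g.IsIsothermal s a) (hT : 0 < T) :
    g.sigmaOne * g.boundaryLength = 2 * π * flatSigma (s T) := by
  have hTm : (T, (0 : ℝ)) ∈ strip T := mem_strip.2 ⟨by linarith, le_rfl⟩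
  have hr := Real.sqrt_pos.2 (g.G_pos hTm)
  rw [H.sigmaOne_eq hT, boundaryLength]
  simp only [H.G_boundary, intervalIntegral.integral_const, sub_zero, smul_eq_mul]
  field_simp

end IsIsothermal

end Metric

/-! ### Existence of isothermal coordinates -/

/-- The nearest point of `[-T, T]`. -/
def clamp (T t : ℝ) : ℝ := max (-T) (min T t)

theorem clamp_mem {T : ℝ} (hT : 0 < T) (t : ℝ) : clamp T t ∈ Icc (-T) T :=
  ⟨le_max_left _ _, max_le (by linarith) (min_le_left _ _)⟩

theorem clamp_of_mem {T t : ℝ} (ht : t ∈ Icc (-T) T) : clamp T t = t := by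
  rw [clamp, min_eq_right ht.2, max_eq_right ht.1]

theorem clamp_neg {T : ℝ} (hT : 0 < T) (t : ℝ) : clamp T (-t) = -clamp T t := by
  simp only [clamp]
  rcases le_total t T with h1 | h1 <;> rcases le_total (-T) t with h2 | h2
  · rw [min_eq_right (by linarith : -t ≤ T), max_eq_right (by linarith), min_eq_right h1,
      max_eq_right h2]
  · rw [min_eq_left (by linarith : T ≤ -t), max_eq_right (by linarith), min_eq_right h1,
      max_eq_left h2, neg_neg]
  · rw [min_eq_right (by linarith : -t ≤ T), max_eq_left (by linarith), min_eq_left h1,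
      max_eq_right (by linarith)]
  · linarith

/-- The primitive of `f` from `0`, with `f` extended by constants off `[-T, T]`. -/
def primitive (T : ℝ) (f : ℝ → ℝ) (t : ℝ) : ℝ := ∫ x in (0 : ℝ)..t, f (clamp T x)

theorem hasDerivAt_primitive {T : ℝ} (hT : 0 < T) {f : ℝ → ℝ} (hf : ContinuousOn f (Icc (-T) T))
    (t : ℝ) : HasDerivAt (primitive T f) (f (clamp T t)) t := by
  have hc : Continuous fun x => f (clamp T x) :=
    hf.comp_continuous (by unfold clamp; fun_prop) (clamp_mem hT)
  exact intervalIntegral.integral_hasDerivAt_right (hc.intervalIntegrable _ _)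
    (hc.stronglyMeasurableAtFilter _ _) hc.continuousAt

theorem hasDerivWithinAt_primitive {T : ℝ} (hT : 0 < T) {f : ℝ → ℝ}
    (hf : ContinuousOn f (Icc (-T) T)) {t : ℝ} (ht : t ∈ Icc (-T) T) :
    HasDerivWithinAt (primitive T f) (f t) (Icc (-T) T) t := by
  have := (hasDerivAt_primitive hT hf t).hasDerivWithinAt (s := Icc (-T) T)
  rwa [clamp_of_mem ht] at this

theorem contDiffOn_primitive {T : ℝ} (hT : 0 < T) {f : ℝ → ℝ} (hf : ContDiffOn ℝ ∞ f (Icc (-T) T)) :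
    ContDiffOn ℝ ∞ (primitive T f) (Icc (-T) T) := by
  have hu := uniqueDiffOn_Icc (by linarith : -T < T)
  rw [contDiffOn_infty_iff_derivWithin hu]
  refine ⟨fun t ht => (hasDerivWithinAt_primitive hT hf.continuousOn ht).differentiableWithinAt,
    hf.congr fun t ht => ?_⟩
  exact (hasDerivWithinAt_primitive hT hf.continuousOn ht).derivWithin (hu t ht)

theorem primitive_neg_of_even {T : ℝ} (hT : 0 < T) {f : ℝ → ℝ}
    (hf : ∀ t ∈ Icc (-T) T, f (-t) = f t) (t : ℝ) : primitive T f (-t) = -primitive T f t := by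
  have h := intervalIntegral.integral_comp_neg (a := 0) (b := t) (fun x => f (clamp T x))
  simp only [clamp_neg hT, neg_zero, hf _ (clamp_mem hT _)] at h
  rw [primitive, primitive, h, intervalIntegral.integral_symm]

theorem primitive_neg_of_odd {T : ℝ} (hT : 0 < T) {f : ℝ → ℝ}
    (hf : ∀ t ∈ Icc (-T) T, f (-t) = -f t) (t : ℝ) : primitive T f (-t) = primitive T f t := by
  have h := intervalIntegral.integral_comp_neg (a := 0) (b := t) (fun x => f (clamp T x))
  simp only [clamp_neg hT, neg_zero, hf _ (clamp_mem hT _), intervalIntegral.integral_neg] at h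
  rw [primitive, primitive, intervalIntegral.integral_symm, ← h, neg_neg]

namespace Metric

variable {T : ℝ} {g : Metric T}

namespace IsRotationallySymmetric

theorem coeff_eq (hg : g.IsRotationallySymmetric) {t : ℝ} (ht : t ∈ Icc (-T) T) (θ : ℝ) :
    g.E (t, θ) = g.E (t, 0) ∧ g.F (t, θ) = g.F (t, 0) ∧ g.G (t, θ) = g.G (t, 0) := by
  simpa using hg (t, 0) (mem_strip.2 ht) θ

theorem density_eq (hg : g.IsRotationallySymmetric) {t : ℝ} (ht : t ∈ Icc (-T) T) (θ : ℝ) :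
    g.density (t, θ) = g.density (t, 0) := by
  obtain ⟨h1, h2, h3⟩ := hg.coeff_eq ht θ
  simp only [density, h1, h2, h3]

/-- A rotationally symmetric metric has the isothermal coordinates
`s = ∫ √(EG - F²) / G dt`, `θ + ∫ F / G dt`. -/
theorem exists_isIsothermal (hT : 0 < T) (hg : g.IsRotationallySymmetric) :
    ∃ s a, g.IsIsothermal s a := by
  have hslice : ContDiffOn ℝ ∞ (fun t : ℝ => (t, (0 : ℝ))) (Icc (-T) T) := by fun_prop
  have hmaps : MapsTo (fun t : ℝ => (t, (0 : ℝ))) (Icc (-T) T) (strip T) :=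
    fun t ht => mem_strip.2 ht
  have hκ : ContDiffOn ℝ ∞ (fun t => g.density (t, 0) / g.G (t, 0)) (Icc (-T) T) :=
    (g.contDiffOn_density.div g.smooth_G fun p hp => (g.G_pos hp).ne').comp hslice hmaps
  have hρ : ContDiffOn ℝ ∞ (fun t => g.F (t, 0) / g.G (t, 0)) (Icc (-T) T) :=
    (g.smooth_F.div g.smooth_G fun p hp => (g.G_pos hp).ne').comp hslice hmaps
  have hneg : ∀ t ∈ Icc (-T) T, g.density (-t, 0) = g.density (t, 0) ∧
      g.F (-t, 0) = -g.F (t, 0) ∧ g.G (-t, 0) = g.G (t, 0) := by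
    intro t ht
    have hp : (t, (0 : ℝ)) ∈ strip T := mem_strip.2 ht
    have ht' : -t ∈ Icc (-T) T := ⟨by linarith [ht.2], by linarith [ht.1]⟩
    have e : deck (t, 0) = (-t, π) := by simp [deck]
    have h1 := g.density_deck hp
    have h2 := g.F_deck _ hp
    have h3 := g.G_deck _ hp
    rw [e] at h1 h2 h3
    obtain ⟨-, h4, h5⟩ := hg.coeff_eq ht' π
    exact ⟨by rw [← h1, hg.density_eq ht' π], by rw [← h2, h4], by rw [← h3, h5]⟩
  refine ⟨primitive T fun t => g.density (t, 0) / g.G (t, 0),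
    primitive T fun t => g.F (t, 0) / g.G (t, 0), ?_⟩
  refine ⟨contDiffOn_primitive hT hκ, contDiffOn_primitive hT hρ,
    primitive_neg_of_even hT fun t ht => ?_, primitive_neg_of_odd hT fun t ht => ?_,
    fun t θ ht => ?_, fun t θ ht => ?_, fun θ => ?_⟩
  · simp only [hneg t ht]
  · simp only [hneg t ht, neg_div]
  · rw [hg.density_eq ht θ, (hg.coeff_eq ht θ).2.2]
    exact hasDerivWithinAt_primitive hT hκ.continuousOn ht
  · rw [(hg.coeff_eq ht θ).2.1, (hg.coeff_eq ht θ).2.2]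
    exact hasDerivWithinAt_primitive hT hρ.continuousOn ht
  · exact (hg.coeff_eq ⟨by linarith, le_rfl⟩ θ).2.2

end IsRotationallySymmetric

/-! ### The conformal diffeomorphism to the flat band -/

namespace IsIsothermal

variable {s a : ℝ → ℝ}

theorem s_mapsTo (H : g.IsIsothermal s a) : MapsTo s (Icc (-T) T) (Icc (-s T) (s T)) := by
  intro t ht
  have h0 : -T ≤ T := ht.1.trans ht.2
  rw [← H.s_neg]
  exact ⟨H.s_strictMonoOn.monotoneOn ⟨le_rfl, h0⟩ ht ht.1,
    H.s_strictMonoOn.monotoneOn ht ⟨h0, le_rfl⟩ ht.2⟩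

theorem s_surjOn (H : g.IsIsothermal s a) (hT : 0 < T) :
    SurjOn s (Icc (-T) T) (Icc (-s T) (s T)) := by
  rw [← H.s_neg]
  exact intermediate_value_Icc (by linarith) H.contDiffOn_s.continuousOn

/-- The isothermal coordinate `s` has a smooth inverse, up to the boundary. -/
theorem exists_inverse (H : g.IsIsothermal s a) (hT : 0 < T) :
    ∃ ψ : ℝ → ℝ, ContDiffOn ℝ ∞ ψ (Icc (-s T) (s T)) ∧
      MapsTo ψ (Icc (-s T) (s T)) (Icc (-T) T) ∧
      (∀ t ∈ Icc (-T) T, ψ (s t) = t) ∧ (∀ x ∈ Icc (-s T) (s T), s (ψ x) = x) := by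
  have hS := H.s_T_pos hT
  have hmaps : MapsTo (Function.invFunOn s (Icc (-T) T)) (Icc (-s T) (s T)) (Icc (-T) T) :=
    fun x hx => Function.invFunOn_mem (H.s_surjOn hT hx)
  have hright : ∀ x ∈ Icc (-s T) (s T), s (Function.invFunOn s (Icc (-T) T) x) = x :=
    fun x hx => Function.invFunOn_eq (H.s_surjOn hT hx)
  set ψ := Function.invFunOn s (Icc (-T) T)
  have hcont : ContinuousOn ψ (Icc (-s T) (s T)) := by
    have hs : Continuous fun t : Icc (-T) T => s t :=
      H.contDiffOn_s.continuousOn.comp_continuous continuous_subtype_val fun t => t.2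
    have hemb := hs.isClosedEmbedding fun x y h =>
      Subtype.ext (H.s_strictMonoOn.injOn x.2 y.2 h)
    have : Continuous fun x : Icc (-s T) (s T) => (⟨ψ x, hmaps x.2⟩ : Icc (-T) T) := by
      rw [hemb.isInducing.continuous_iff]
      exact continuous_subtype_val.congr fun x => (hright x x.2).symm
    exact continuousOn_iff_continuous_domRestrict.2 (continuous_subtype_val.comp this)
  have hderiv : ∀ x ∈ Icc (-s T) (s T),
      HasDerivWithinAt ψ (g.density (ψ x, 0) / g.G (ψ x, 0))⁻¹ (Icc (-s T) (s T)) x := by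
    intro x hx
    have hp : (ψ x, (0 : ℝ)) ∈ strip T := mem_strip.2 (hmaps hx)
    have hne := (div_pos (g.density_pos hp) (g.G_pos hp)).ne'
    have h1 : HasFDerivWithinAt s (ContinuousLinearEquiv.unitsEquivAut ℝ (Units.mk0 _ hne) :
        ℝ →L[ℝ] ℝ) (Icc (-T) T) (ψ x) := by
      refine (H.hasDeriv_s (ψ x) 0 (hmaps hx)).hasFDerivWithinAt.congr_fderiv ?_
      ext
      simp
    refine (HasFDerivWithinAt.of_local_left_inverse
      ((hcont x hx).tendsto_nhdsWithin hmaps) h1 hx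
      (Filter.eventually_of_mem self_mem_nhdsWithin hright)).hasDerivWithinAt.congr_deriv ?_
    simp [ContinuousLinearEquiv.unitsEquivAut]
  refine ⟨ψ, ?_, hmaps, fun t ht => ?_, hright⟩
  · have hu := uniqueDiffOn_Icc (by linarith : -s T < s T)
    have hκ : ContDiffOn ℝ ∞ (fun t => (g.density (t, 0) / g.G (t, 0))⁻¹) (Icc (-T) T) := by
      refine ((g.contDiffOn_density.div g.smooth_G fun p hp => (g.G_pos hp).ne').inv
        fun p hp => (div_pos (g.density_pos hp) (g.G_pos hp)).ne').comp
        (t := strip T) (f := fun t : ℝ => (t, (0 : ℝ))) (by fun_prop) fun t ht => mem_strip.2 ht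
    -- The derivative of `ψ` is a smooth function of `ψ`, so smoothness bootstraps.
    have hn : ∀ n : ℕ, ContDiffOn ℝ n ψ (Icc (-s T) (s T)) := by
      intro n
      induction n with
      | zero => exact contDiffOn_zero.2 hcont
      | succ n ih =>
        rw [Nat.cast_succ, contDiffOn_succ_iff_derivWithin hu]
        refine ⟨fun x hx => (hderiv x hx).differentiableWithinAt, by simp, ?_⟩
        exact ((hκ.of_le (by exact_mod_cast le_top)).comp ih hmaps).congr fun x hx =>
          (hderiv x hx).derivWithin (hu x hx)
    exact contDiffOn_infty.2 hn
  · exact H.s_strictMonoOn.injOn (hmaps (H.s_mapsTo ht)) ht (hright _ (H.s_mapsTo ht))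

end IsIsothermal

/-- A map of strips commuting with the glide reflection descends to the Möbius bands. -/
theorem deckSetoid_map {T : ℝ} {Φ : ℝ × ℝ → ℝ × ℝ}
    (hΦ : ∀ p ∈ strip T, Φ (deck p) = deck (Φ p)) {p q : ℝ × ℝ} (hp : p ∈ strip T)
    (hq : q ∈ strip T) (h : deckSetoid p q) : deckSetoid (Φ p) (Φ q) := by
  have hpow : ∀ (n : ℕ) (p : ℝ × ℝ), p ∈ strip T →
      (deck ^ n) p ∈ strip T ∧ Φ ((deck ^ n) p) = (deck ^ n) (Φ p) := by
    intro n
    induction n with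
    | zero => intro p hp; exact ⟨hp, rfl⟩
    | succ n ih =>
      intro p hp
      obtain ⟨h1, h2⟩ := ih p hp
      rw [pow_succ', Equiv.Perm.mul_apply, Equiv.Perm.mul_apply, hΦ _ h1, h2]
      exact ⟨deck_mem_strip h1, rfl⟩
  obtain ⟨k, rfl⟩ := h
  obtain ⟨n, rfl | rfl⟩ := k.eq_nat_or_neg
  · refine ⟨n, ?_⟩
    rw [zpow_natCast, (hpow n p hp).2]
  · refine ⟨-n, ?_⟩
    have h1 := (hpow n _ hq).2
    rw [zpow_neg, zpow_natCast, ← Equiv.Perm.mul_apply, mul_inv_cancel, Equiv.Perm.one_apply] at h1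
    rw [zpow_neg, zpow_natCast, h1, ← Equiv.Perm.mul_apply, inv_mul_cancel, Equiv.Perm.one_apply]

/-- A band with isothermal coordinates of half-width `s T = T₂` is `σ`-homothetic to every band of
half-width `T₂` for which the standard coordinates are isothermal. -/
theorem IsIsothermal.sigmaHomothetic {T₂ : ℝ} {g₂ : Metric T₂} {s a : ℝ → ℝ} (hT : 0 < T)
    (H : g.IsIsothermal s a) (H₂ : g₂.IsIsothermal id fun _ => 0) (hs : s T = T₂) :
    g.SigmaHomothetic g₂ := by
  subst hs
  have hS := H.s_T_pos hT
  obtain ⟨ψ, hψ, hψmaps, hψs, hsψ⟩ := H.exists_inverse hT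
  have hmapsΦ : MapsTo (fun p : ℝ × ℝ => (s p.1, p.2 + a p.1)) (strip T) (strip (s T)) :=
    fun p hp => mem_strip.2 (H.s_mapsTo (mem_strip.1 hp))
  have hmapsΨ : MapsTo (fun p : ℝ × ℝ => (ψ p.1, p.2 - a (ψ p.1))) (strip (s T)) (strip T) :=
    fun p hp => mem_strip.2 (hψmaps (mem_strip.1 hp))
  have hΦ : ContDiffOn ℝ ∞ (fun p : ℝ × ℝ => (s p.1, p.2 + a p.1)) (strip T) :=
    (contDiffOn_comp_fst H.contDiffOn_s).prodMk
      (contDiffOn_snd.add (contDiffOn_comp_fst H.contDiffOn_a))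
  refine ⟨fun p => (s p.1, p.2 + a p.1), fun p => (ψ p.1, p.2 - a (ψ p.1)),
    fun p => √(g₂.G (s p.1, p.2 + a p.1) / g.G p), √(g₂.G (s T, 0) / g.G (T, 0)),
    hΦ, ?_, hmapsΦ, hmapsΨ, ?_, ?_, ?_, ?_, ?_, ?_, ?_⟩
  · exact (contDiffOn_comp_fst hψ).prodMk
      (contDiffOn_snd.sub (contDiffOn_comp_fst (H.contDiffOn_a.comp hψ hψmaps)))
  · rintro ⟨t, θ⟩ hp
    simp [hψs t (mem_strip.1 hp)]
  · rintro ⟨t, θ⟩ hp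
    simp [hsψ t (mem_strip.1 hp)]
  · intro p hp q hq h
    refine deckSetoid_map (Φ := fun p => (s p.1, p.2 + a p.1)) (fun r _ => ?_) hp hq h
    simp only [deck, Equiv.coe_fn_mk, H.s_neg, H.a_neg]
    ext <;> simp
    ring
  · intro p hp q hq h
    refine deckSetoid_map (Φ := fun p => (ψ p.1, p.2 - a (ψ p.1))) (fun r hr => ?_) hp hq h
    have hr' := mem_strip.1 hr
    have hneg : ψ (-r.1) = -ψ r.1 := by
      have h1 : -ψ r.1 ∈ Icc (-T) T := by
        have := hψmaps hr'
        exact ⟨by linarith [this.2], by linarith [this.1]⟩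
      rw [← hψs _ h1, H.s_neg, hsψ _ hr']
    simp only [deck, Equiv.coe_fn_mk, hneg, H.a_neg]
    ext <;> simp
    ring
  · intro p hp
    exact Real.sqrt_pos.2 (div_pos (g₂.G_pos (hmapsΦ hp)) (g.G_pos hp))
  · rintro ⟨t, θ⟩ hp v w
    have ht := mem_strip.1 hp
    have hq := hmapsΦ hp
    have hd : HasFDerivWithinAt (fun p : ℝ × ℝ => (s p.1, p.2 + a p.1))
        (((g.density (t, θ) / g.G (t, θ)) • ContinuousLinearMap.fst ℝ ℝ ℝ).prod
          (ContinuousLinearMap.snd ℝ ℝ ℝ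
            + (g.F (t, θ) / g.G (t, θ)) • ContinuousLinearMap.fst ℝ ℝ ℝ)) (strip T) (t, θ) := by
      have hm : MapsTo Prod.fst (strip T) (Icc (-T) T) := fun p hp => mem_strip.1 hp
      have h1 := (H.hasDeriv_s t θ ht).comp_hasFDerivWithinAt (t, θ)
        (hasFDerivWithinAt_fst (𝕜 := ℝ) (s := strip T) (p := (t, θ))) hm
      have h2 := (H.hasDeriv_a t θ ht).comp_hasFDerivWithinAt (t, θ)
        (hasFDerivWithinAt_fst (𝕜 := ℝ) (s := strip T) (p := (t, θ))) hm
      exact h1.prodMk (hasFDerivWithinAt_snd.add h2)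
    rw [hd.fderivWithin (uniqueDiffOn_strip hT _ hp)]
    have hG₂ := g₂.G_pos hq
    have hG := g.G_pos hp
    have hst := H.s_mapsTo ht
    -- In the standard isothermal coordinates, `F = 0` and `E = G`.
    have hu := uniqueDiffOn_Icc (by linarith : -s T < s T)
    have e1 := (hu _ hst).eq_deriv _ (H₂.hasDeriv_s (s t) (θ + a t) hst)
      (hasDerivWithinAt_id (s t) _)
    have e2 := (hu _ hst).eq_deriv _ (H₂.hasDeriv_a (s t) (θ + a t) hst)
      (hasDerivWithinAt_const (s t) _ (0 : ℝ))
    rw [div_eq_iff hG₂.ne', one_mul] at e1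
    rw [div_eq_iff hG₂.ne', zero_mul] at e2
    have hE₂ := g₂.E_mul_G hq
    have hE := g.E_mul_G hp
    simp only [e1, e2] at hE₂
    have e3 : g₂.E (s t, θ + a t) = g₂.G (s t, θ + a t) := by
      apply mul_right_cancel₀ hG₂.ne'
      linarith
    rw [Real.sq_sqrt (div_pos hG₂ hG).le]
    simp only [form, e2, e3, ContinuousLinearMap.prod_apply, smul_apply, add_apply,
      ContinuousLinearMap.coe_fst', ContinuousLinearMap.coe_snd',
      smul_eq_mul]
    field_simp
    linear_combination (-(g₂.G (s t, θ + a t) * v.1 * w.1)) * hE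
  · intro p hp
    simp only
    rw [H.G_of_abs_eq hp, H₂.G_of_abs_eq]
    simp only
    rcases eq_or_eq_neg_of_abs_eq hp with h | h
    · rw [h, abs_of_pos hS]
    · rw [h, H.s_neg, abs_neg, abs_of_pos hS]

end Metric

/-! ### The critical half-width -/

/-- The positive solution of `coth t = 2 tanh 2t`; equivalently `sinh² t = 1/2`. -/
def criticalT : ℝ := arsinh (√2)⁻¹

theorem criticalT_pos : 0 < criticalT :=
  Real.arsinh_pos_iff.2 (by positivity)

theorem sinh_criticalT_sq : sinh criticalT ^ 2 = 1 / 2 := by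
  rw [criticalT, sinh_arsinh, inv_pow, Real.sq_sqrt (by norm_num)]
  norm_num

theorem cosh_criticalT_sq : cosh criticalT ^ 2 = 3 / 2 := by
  rw [cosh_sq, sinh_criticalT_sq]; norm_num

theorem coth_eq_iff {t : ℝ} (ht : 0 < t) :
    cosh t / sinh t = 2 * tanh (2 * t) ↔ t = criticalT := by
  have hs := Real.sinh_pos_iff.2 ht
  have hc := cosh_pos t
  have hcs := cosh_sq t
  have h1 : cosh t / sinh t = 2 * tanh (2 * t) ↔ sinh t ^ 2 = 1 / 2 := by
    rw [tanh_eq_sinh_div_cosh, sinh_two_mul, cosh_two_mul, mul_div_assoc',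
      div_eq_div_iff hs.ne' (by positivity)]
    constructor
    · intro h
      have : cosh t * (1 - 2 * sinh t ^ 2) = 0 := by
        rw [hcs] at h
        linear_combination h
      have := (mul_eq_zero.1 this).resolve_left hc.ne'
      linarith
    · intro h
      rw [hcs]
      linear_combination (-2 * cosh t) * h
  rw [h1, ← sinh_criticalT_sq]
  constructor
  · intro h
    exact Real.sinh_injective
      ((pow_left_inj₀ hs.le (Real.sinh_pos_iff.2 criticalT_pos).le two_ne_zero).1 h)
  · rintro rfl; rfl

theorem coth_criticalT : cosh criticalT / sinh criticalT = √3 := by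
  have hs := Real.sinh_pos_iff.2 criticalT_pos
  have hc := cosh_pos criticalT
  rw [eq_comm, Real.sqrt_eq_iff_mul_self_eq (by norm_num) (by positivity)]
  field_simp
  rw [cosh_criticalT_sq, sinh_criticalT_sq]
  norm_num

theorem two_mul_tanh_criticalT : 2 * tanh (2 * criticalT) = √3 := by
  rw [← coth_criticalT, (coth_eq_iff criticalT_pos).2 rfl]

theorem flatSigma_criticalT : flatSigma criticalT = √3 := by
  rw [flatSigma, coth_criticalT, two_mul_tanh_criticalT, min_self]

/-- Off the critical half-width one of `coth S` (decreasing) and `2 tanh 2S` (increasing) is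
below its critical value. -/
theorem flatSigma_lt {S : ℝ} (h : S ≠ criticalT) : flatSigma S < √3 := by
  rcases h.lt_or_gt with h | h
  · refine (min_le_right _ _).trans_lt ?_
    rw [← two_mul_tanh_criticalT]
    linarith [tanh_lt_tanh (by linarith : 2 * S < 2 * criticalT)]
  · refine (min_le_left _ _).trans_lt ?_
    rw [← coth_criticalT]
    exact coth_lt_coth criticalT_pos h

theorem flatSigma_le_sqrt_three (S : ℝ) : flatSigma S ≤ √3 := by
  rcases eq_or_ne S criticalT with h | h
  · rw [h, flatSigma_criticalT]
  · exact (flatSigma_lt h).le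

/-! ### The explicit map is an embedding -/

theorem deck_zpow_apply (k : ℤ) (t θ : ℝ) : (deck ^ k) (t, θ) = ((-1) ^ k * t, θ + k * π) := by
  have hnat : ∀ (n : ℕ) (t θ : ℝ), (deck ^ n) (t, θ) = ((-1) ^ n * t, θ + n * π) := by
    intro n
    induction n with
    | zero => intro t θ; simp
    | succ n ih =>
      intro t θ
      rw [pow_succ', Equiv.Perm.mul_apply, ih]
      ext
      · simp only [deck, Equiv.coe_fn_mk]; ring
      · simp only [deck, Equiv.coe_fn_mk]; push_cast; ring
  obtain ⟨n, rfl | rfl⟩ := k.eq_nat_or_neg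
  · simpa using hnat n t θ
  · rw [zpow_neg, zpow_natCast, Equiv.Perm.inv_eq_iff_eq, hnat]
    ext
    · simp only [zpow_neg, zpow_natCast, ← mul_assoc]
      rw [mul_inv_cancel₀ (pow_ne_zero _ (by norm_num)), one_mul]
    · push_cast; ring

theorem norm_phiFun (p : ℝ × ℝ) : ‖phiFun p‖ = radius p.1 := by
  rw [EuclideanSpace.norm_eq, radius, Fin.sum_univ_four]
  congr 1
  simp only [Real.norm_eq_abs, sq_abs]
  simp [phiFun]
  linear_combination (4 * sinh p.1 ^ 2) * sin_sq_add_cos_sq p.2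
    + cosh (2 * p.1) ^ 2 * sin_sq_add_cos_sq (2 * p.2)

theorem radius_sq_eq (t : ℝ) : radius t ^ 2 = (cosh (2 * t) + 1) ^ 2 - 3 := by
  rw [radius, Real.sq_sqrt (by positivity)]
  have h1 := cosh_two_mul t
  have h2 := cosh_sq t
  linear_combination (-2) * h1 + (-2) * h2

theorem radius_le_radius_iff {t r : ℝ} : radius t ≤ radius r ↔ |t| ≤ |r| := by
  rw [← pow_le_pow_iff_left₀ (radius_pos t).le (radius_pos r).le two_ne_zero, radius_sq_eq,
    radius_sq_eq, sub_le_sub_iff_right, pow_le_pow_iff_left₀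
    (by have := cosh_pos (2 * t); positivity) (by have := cosh_pos (2 * r); positivity)
    two_ne_zero, add_le_add_iff_right, cosh_le_cosh, abs_mul, abs_mul, abs_two,
    mul_le_mul_iff_right₀ (by norm_num)]

theorem radius_eq_radius_iff {t r : ℝ} : radius t = radius r ↔ |t| = |r| := by
  simp only [le_antisymm_iff, radius_le_radius_iff]

/-- The norm determines `|t|`; the first two coordinates (the last two when `t = 0`) then determine
`θ` up to the powers of the glide reflection. -/
theorem deckSetoid_of_phiFun_eq {p q : ℝ × ℝ} (h : phiFun p = phiFun q) : deckSetoid p q := by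
  obtain ⟨t, θ⟩ := p
  obtain ⟨r, η⟩ := q
  have habs : |t| = |r| := by
    rw [← radius_eq_radius_iff, ← norm_phiFun (t, θ), h, norm_phiFun]
  have e0 := congrArg (fun x : E4 => x 0) h
  have e1 := congrArg (fun x : E4 => x 1) h
  have e2 := congrArg (fun x : E4 => x 2) h
  have e3 := congrArg (fun x : E4 => x 3) h
  simp [phiFun] at e0 e1 e2 e3
  -- Equality of cosine and sine of two angles.
  have key : ∀ x y : ℝ, cos x = cos y → sin x = sin y → ∃ k : ℤ, y = x + k * (2 * π) := by
    intro x y hc hs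
    obtain ⟨k, hk⟩ := Real.Angle.angle_eq_iff_two_pi_dvd_sub.1
      (Real.Angle.cos_sin_inj hc.symm hs.symm)
    exact ⟨k, by linarith⟩
  rcases eq_or_ne t 0 with h0 | h0
  · have hr : r = 0 := by simpa [h0] using habs.symm
    subst h0 hr
    simp only [mul_zero, cosh_zero, one_mul] at e2 e3
    obtain ⟨k, hk⟩ := key _ _ e2 e3
    refine ⟨k, ?_⟩
    rw [deck_zpow_apply]
    ext
    · simp
    · simp only; linarith
  · have hsinh : sinh t ≠ 0 := by rwa [Ne, Real.sinh_eq_zero]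
    rcases abs_eq_abs.1 habs with hr | hr
    · subst hr
      obtain ⟨k, hk⟩ := key θ η (by
        have : sinh t * cos θ = sinh t * cos η := by linarith
        exact mul_left_cancel₀ hsinh this) (by
        have : sinh t * sin θ = sinh t * sin η := by linarith
        exact mul_left_cancel₀ hsinh this)
      refine ⟨2 * k, ?_⟩
      rw [deck_zpow_apply, (even_two_mul k).neg_one_zpow]
      ext
      · simp
      · simp only; push_cast; linarith
    · obtain rfl : r = -t := by linarith
      rw [sinh_neg] at e0 e1
      obtain ⟨k, hk⟩ := key (θ + π) η (by
        have : sinh t * cos (θ + π) = sinh t * cos η := by rw [cos_add_pi]; linarith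
        exact mul_left_cancel₀ hsinh this) (by
        have : sinh t * sin (θ + π) = sinh t * sin η := by rw [sin_add_pi]; linarith
        exact mul_left_cancel₀ hsinh this)
      refine ⟨2 * k + 1, ?_⟩
      rw [deck_zpow_apply, (odd_two_mul_add_one k).neg_one_zpow]
      ext
      · simp
      · simp only; push_cast; linarith

namespace Immersion

theorem continuous_onBand (ψ : Immersion) : Continuous ψ.onBand :=
  ψ.smooth.continuous.quotient_lift _

end Immersion

/-- Every point of the band has a representative with angle in `[0, 2π]`. -/
theorem exists_angle_mem_Icc (t θ : ℝ) : ∃ η ∈ Icc (0 : ℝ) (2 * π),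
    (Quotient.mk deckSetoid (t, θ)) = Quotient.mk deckSetoid (t, η) := by
  obtain ⟨k, hk, -⟩ := existsUnique_add_zsmul_mem_Ico two_pi_pos θ 0
  refine ⟨θ + k • (2 * π), ⟨hk.1, by linarith [hk.2]⟩, Quotient.sound ⟨2 * k, ?_⟩⟩
  rw [deck_zpow_apply, (even_two_mul k).neg_one_zpow]
  ext
  · simp
  · simp only [zsmul_eq_mul]; push_cast; ring

/-- The explicit map is injective and proper on the band, hence a closed embedding. -/
theorem isClosedEmbedding_phi : Topology.IsClosedEmbedding phi.onBand := by
  have hc := phi.continuous_onBand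
  refine Topology.IsClosedEmbedding.of_continuous_injective_isClosedMap hc ?_ ?_
  · rintro ⟨p⟩ ⟨q⟩ h
    exact Quotient.sound (deckSetoid_of_phiFun_eq h)
  · refine IsProperMap.isClosedMap (isProperMap_iff_isCompact_preimage.2 ⟨hc, fun K hK => ?_⟩)
    obtain ⟨C, hC⟩ := hK.isBounded.exists_norm_le
    have hrect : IsCompact ((Quotient.mk deckSetoid) '' (Icc (-C) C ×ˢ Icc (0 : ℝ) (2 * π))) :=
      (isCompact_Icc.prod isCompact_Icc).image continuous_quotient_mk'
    refine hrect.of_isClosed_subset (hK.isClosed.preimage hc) ?_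
    rintro ⟨t, θ⟩ hp
    obtain ⟨η, hη, heq⟩ := exists_angle_mem_Icc t θ
    refine ⟨(t, η), ⟨?_, hη⟩, heq.symm⟩
    have h1 : radius t ≤ C := by
      rw [← norm_phiFun (t, θ)]
      exact hC _ hp
    -- `|t| ≤ cosh 2t ≤ radius t`, the norm of the image point.
    have h2 : |t| ≤ radius t := by
      have h3 : cosh (2 * t) ≤ radius t := Real.le_sqrt_of_sq_le (by nlinarith [sq_nonneg (sinh t)])
      have h4 : |t| ≤ cosh (2 * t) := by
        rw [← cosh_abs, abs_mul, abs_two]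
        have h5 := Real.self_le_sinh_iff.2 (by positivity : 0 ≤ 2 * |t|)
        have h6 := Real.sinh_lt_cosh (2 * |t|)
        linarith [abs_nonneg t]
      exact h4.trans h3
    exact abs_le.1 (h2.trans h1)

/-! ### Dilations of the explicit map -/

namespace Immersion

/-- `ψ` is the dilation of the explicit map by the positive factor `c`. -/
structure IsDilationOfPhi (ψ : Immersion) (c : ℝ) : Prop where
  pos : 0 < c
  eq : ∀ p, ψ.toFun p = c • phiFun p

theorem isDilationOfPhi_phi : phi.IsDilationOfPhi 1 := ⟨one_pos, fun _ => (one_smul ℝ _).symm⟩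

theorem isDilationOfPhi_unitPhi (T : ℝ) : (unitPhi T).IsDilationOfPhi (radius T)⁻¹ :=
  ⟨inv_pos.2 (radius_pos T), fun _ => rfl⟩

namespace IsDilationOfPhi

variable {ψ : Immersion} {c : ℝ}

theorem d_eq (h : ψ.IsDilationOfPhi c) (p v : ℝ × ℝ) : ψ.d p v = c • fderiv ℝ phiFun p v := by
  have e : ψ.toFun = c • phiFun := funext h.eq
  rw [d, e, fderiv_const_smul (contDiff_phiFun.differentiable (by simp) p) c]
  rfl

theorem d_et (h : ψ.IsDilationOfPhi c) (p : ℝ × ℝ) : ψ.d p et =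
    c • !₂[2 * (cosh p.1 * cos p.2), 2 * (cosh p.1 * sin p.2),
      2 * (sinh (2 * p.1) * cos (2 * p.2)), 2 * (sinh (2 * p.1) * sin (2 * p.2))] := by
  rw [h.d_eq, fderiv_phiFun_apply]
  simp [et]

theorem d_eθ (h : ψ.IsDilationOfPhi c) (p : ℝ × ℝ) : ψ.d p eθ =
    c • !₂[-(2 * (sinh p.1 * sin p.2)), 2 * (sinh p.1 * cos p.2),
      -(2 * (cosh (2 * p.1) * sin (2 * p.2))), 2 * (cosh (2 * p.1) * cos (2 * p.2))] := by
  rw [h.d_eq, fderiv_phiFun_apply]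
  simp [eθ]

theorem inner_et_et (h : ψ.IsDilationOfPhi c) (p : ℝ × ℝ) :
    inner ℝ (ψ.d p et) (ψ.d p et) = c ^ 2 * (4 * (cosh p.1 ^ 2 + sinh (2 * p.1) ^ 2)) := by
  rw [h.d_et, PiLp.inner_apply, Fin.sum_univ_four]
  simp [mul_pow]
  linear_combination (4 * c ^ 2 * cosh p.1 ^ 2) * sin_sq_add_cos_sq p.2
    + (4 * c ^ 2 * sinh (2 * p.1) ^ 2) * sin_sq_add_cos_sq (2 * p.2)

theorem inner_et_eθ (h : ψ.IsDilationOfPhi c) (p : ℝ × ℝ) :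
    inner ℝ (ψ.d p et) (ψ.d p eθ) = 0 := by
  rw [h.d_et, h.d_eθ, PiLp.inner_apply, Fin.sum_univ_four]
  simp
  ring

theorem inner_eθ_eθ (h : ψ.IsDilationOfPhi c) (p : ℝ × ℝ) :
    inner ℝ (ψ.d p eθ) (ψ.d p eθ) = c ^ 2 * (4 * (cosh p.1 ^ 2 + sinh (2 * p.1) ^ 2)) := by
  rw [h.d_eθ, PiLp.inner_apply, Fin.sum_univ_four]
  simp [mul_pow]
  linear_combination (4 * c ^ 2 * sinh p.1 ^ 2) * sin_sq_add_cos_sq p.2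
    + (4 * c ^ 2 * cosh (2 * p.1) ^ 2) * sin_sq_add_cos_sq (2 * p.2)
    - (4 * c ^ 2) * cosh_sq p.1 + (4 * c ^ 2) * cosh_sq (2 * p.1)

theorem isRotationallySymmetric (h : ψ.IsDilationOfPhi c) (T : ℝ) :
    (ψ.metric T).IsRotationallySymmetric := by
  intro p _ a
  simp only [metric, h.inner_et_et, h.inner_et_eθ, h.inner_eθ_eθ, and_self]

/-- The induced metric is conformal to `dt² + dθ²`. -/
theorem isIsothermal (h : ψ.IsDilationOfPhi c) (T : ℝ) :
    (ψ.metric T).IsIsothermal id fun _ => 0 where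
  contDiffOn_s := contDiffOn_id
  contDiffOn_a := contDiffOn_const
  s_neg _ := rfl
  a_neg _ := rfl
  hasDeriv_s t θ ht := by
    have hG := (ψ.metric T).G_pos (mem_strip.2 ht : (t, θ) ∈ strip T)
    have hD : (ψ.metric T).density (t, θ) = (ψ.metric T).G (t, θ) := by
      rw [Metric.density, Real.sqrt_eq_iff_mul_self_eq _ hG.le]
      · simp only [metric, h.inner_et_et, h.inner_et_eθ, h.inner_eθ_eθ]; ring
      · exact ((ψ.metric T).det_pos _ (mem_strip.2 ht)).le
    rw [hD, div_self hG.ne']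
    exact hasDerivWithinAt_id t _
  hasDeriv_a t θ ht := by
    have hF : (ψ.metric T).F (t, θ) = 0 := h.inner_et_eθ _
    rw [hF, zero_div]
    exact hasDerivWithinAt_const _ _ _
  G_boundary θ := by simp only [metric, h.inner_eθ_eθ]

theorem fderiv_et_eq {f : ℝ × ℝ → E4} {p : ℝ × ℝ} {d : E4} (hf : DifferentiableAt ℝ f p)
    (hd : ∀ i, HasDerivAt (fun r => f (r, p.2) i) (d i) p.1) : fderiv ℝ f p et = d := by
  have h : HasDerivAt (fun r : ℝ => (r, p.2)) et p.1 :=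
    (hasDerivAt_id p.1).prodMk (hasDerivAt_const p.1 p.2)
  have h1 := hf.hasFDerivAt.comp_hasDerivAt p.1 h
  ext i
  exact ((EuclideanSpace.proj (𝕜 := ℝ) i).hasFDerivAt.comp_hasDerivAt p.1 h1).unique (hd i)

theorem fderiv_eθ_eq {f : ℝ × ℝ → E4} {p : ℝ × ℝ} {d : E4} (hf : DifferentiableAt ℝ f p)
    (hd : ∀ i, HasDerivAt (fun r => f (p.1, r) i) (d i) p.2) : fderiv ℝ f p eθ = d := by
  have h : HasDerivAt (fun r : ℝ => (p.1, r)) eθ p.2 :=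
    (hasDerivAt_const p.2 p.1).prodMk (hasDerivAt_id p.2)
  have h1 := hf.hasFDerivAt.comp_hasDerivAt p.2 h
  ext i
  exact ((EuclideanSpace.proj (𝕜 := ℝ) i).hasFDerivAt.comp_hasDerivAt p.2 h1).unique (hd i)

theorem hasDerivAt_two_mul (x : ℝ) : HasDerivAt (fun x : ℝ => 2 * x) 2 x := by
  simpa using (hasDerivAt_id x).const_mul 2

/-- The coordinates are harmonic for `dt² + dθ²`. -/
theorem secondDeriv_add (h : ψ.IsDilationOfPhi c) (p : ℝ × ℝ) :
    fderiv ℝ (fun q => ψ.d q et) p et + fderiv ℝ (fun q => ψ.d q eθ) p eθ = 0 := by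
  have d1 := (ψ.contDiff_d et).differentiable (by simp) p
  have d2 := (ψ.contDiff_d eθ).differentiable (by simp) p
  have e1 : fderiv ℝ (fun q => ψ.d q et) p et =
      c • !₂[2 * (sinh p.1 * cos p.2), 2 * (sinh p.1 * sin p.2),
      4 * (cosh (2 * p.1) * cos (2 * p.2)), 4 * (cosh (2 * p.1) * sin (2 * p.2))] := by
    refine fderiv_et_eq d1 fun i => ?_
    simp only [h.d_et]
    have h1 := hasDerivAt_cosh p.1
    have h2 := (hasDerivAt_two_mul p.1).sinh
    fin_cases i
    · exact ((h1.mul_const (cos p.2)).const_mul 2).const_mul c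
    · exact ((h1.mul_const (sin p.2)).const_mul 2).const_mul c
    · refine (((h2.mul_const (cos (2 * p.2))).const_mul 2).const_mul c).congr_deriv ?_
      change _ = c * (4 * (cosh (2 * p.1) * cos (2 * p.2)))
      ring
    · refine (((h2.mul_const (sin (2 * p.2))).const_mul 2).const_mul c).congr_deriv ?_
      change _ = c * (4 * (cosh (2 * p.1) * sin (2 * p.2)))
      ring
  have e2 : fderiv ℝ (fun q => ψ.d q eθ) p eθ =
      -(c • !₂[2 * (sinh p.1 * cos p.2), 2 * (sinh p.1 * sin p.2),
      4 * (cosh (2 * p.1) * cos (2 * p.2)), 4 * (cosh (2 * p.1) * sin (2 * p.2))]) := by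
    refine fderiv_eθ_eq d2 fun i => ?_
    simp only [h.d_eθ]
    have h1 := hasDerivAt_sin p.2
    have h2 := hasDerivAt_cos p.2
    have h3 := (hasDerivAt_two_mul p.2).sin
    have h4 := (hasDerivAt_two_mul p.2).cos
    fin_cases i
    · exact (((h1.const_mul (sinh p.1)).const_mul 2).neg.const_mul c).congr_deriv (by simp)
    · exact (((h2.const_mul (sinh p.1)).const_mul 2).const_mul c).congr_deriv (by simp)
    · refine (((h3.const_mul (cosh (2 * p.1))).const_mul 2).neg.const_mul c).congr_deriv ?_
      change _ = -(c * (4 * (cosh (2 * p.1) * cos (2 * p.2))))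
      ring
    · refine (((h4.const_mul (cosh (2 * p.1))).const_mul 2).const_mul c).congr_deriv ?_
      change _ = -(c * (4 * (cosh (2 * p.1) * sin (2 * p.2))))
      ring
  rw [e1, e2, add_neg_cancel]

theorem isMinimal (h : ψ.IsDilationOfPhi c) : ψ.IsMinimal := by
  intro p
  simp only [meanCurvature, h.inner_et_et, h.inner_et_eθ, h.inner_eθ_eθ, secondFundamentalForm]
  rw [mul_zero, zero_smul, sub_zero, ← smul_add, ← map_add, h.secondDeriv_add, map_zero,
    smul_zero, smul_zero]

theorem isProperEmbeddingInBall (h : ψ.IsDilationOfPhi c) {T : ℝ} (hT : 0 < T) :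
    ψ.IsProperEmbeddingInBall T (c * radius T) := by
  constructor
  · have e : ψ.onBand = (Homeomorph.smulOfNeZero c h.pos.ne') ∘ phi.onBand := by
      ext x : 1
      obtain ⟨p⟩ := x
      exact h.eq p
    have h1 : Topology.IsEmbedding ψ.onBand := by
      rw [e]
      exact (Homeomorph.isEmbedding _).comp isClosedEmbedding_phi.isEmbedding
    exact h1.comp Topology.IsEmbedding.subtypeVal
  · intro p hp
    have hn : ‖ψ.toFun p‖ = c * radius p.1 := by
      rw [h.eq, norm_smul, norm_phiFun, Real.norm_of_nonneg h.pos.le]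
    have hp' : |p.1| ≤ |T| := by rw [abs_of_pos hT]; exact hp
    rw [hn, mul_le_mul_iff_right₀ h.pos, mul_right_inj' h.pos.ne', radius_eq_radius_iff,
      radius_le_radius_iff, abs_of_pos hT]
    exact ⟨hp, Iff.rfl⟩

/-- At the critical half-width, `sinh² t = 1/2` makes the unit conormal `± φₜ / √E` parallel to
the position vector. -/
theorem meetsBallOrthogonally (h : ψ.IsDilationOfPhi c) :
    ψ.MeetsBallOrthogonally criticalT (c * radius criticalT) := by
  rintro ⟨t, θ⟩ hp ⟨v₁, v₂⟩ ⟨h1, h2, h3⟩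
  simp only at hp h3
  have hs : sinh t ^ 2 = 1 / 2 := by
    rw [← sinh_criticalT_sq, ← sq_abs, abs_sinh, hp]
  have hc : cosh t ^ 2 = 3 / 2 := by rw [cosh_sq, hs]; norm_num
  have hcp := cosh_pos t
  have hc2 : cosh (2 * t) = 2 := by rw [cosh_two_mul, hs, hc]; norm_num
  have hs2 : sinh (2 * t) ^ 2 = 3 := by rw [sinh_two_mul, mul_pow, mul_pow, hs, hc]; norm_num
  have hR : radius criticalT ^ 2 = 6 := by
    rw [radius, Real.sq_sqrt (by positivity), sinh_criticalT_sq, ← cosh_abs, abs_mul,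
      abs_of_pos criticalT_pos, ← hp, ← abs_mul, cosh_abs, hc2]
    norm_num
  have hRp := radius_pos criticalT
  set R := radius criticalT
  have hcpos := h.pos
  simp only [Metric.form, metric, h.inner_et_et, h.inner_et_eθ, h.inner_eθ_eθ, hc, hs2] at h1 h2
  simp only [eθ] at h2
  obtain rfl : v₂ = 0 := by
    have : c ^ 2 * 18 * v₂ = 0 := by linarith
    exact (mul_eq_zero.1 this).resolve_left (by positivity)
  -- `y = c R v₁` is the common ratio; it equals `tanh t = ± 1/√3`.
  have hy2 : (c * R * v₁) ^ 2 = 1 / 3 := by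
    have : c ^ 2 * 18 * v₁ ^ 2 = 1 := by linarith
    rw [mul_pow, mul_pow, hR]
    linarith
  have hsign : 0 < (c * R * v₁ * cosh t) * sinh t := by
    have hts : 0 < t * sinh t := by
      rcases lt_trichotomy t 0 with ht | ht | ht
      · exact mul_pos_of_neg_of_neg ht (Real.sinh_neg_iff.2 ht)
      · simp [ht] at h3
      · exact mul_pos ht (Real.sinh_pos_iff.2 ht)
    have hvs : 0 < v₁ * sinh t := by
      by_contra hneg
      have h5 : 0 < (t * v₁) * (t * sinh t) := mul_pos h3 hts
      have h6 : (t * v₁) * (t * sinh t) = t ^ 2 * (v₁ * sinh t) := by ring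
      have h7 := mul_nonneg (sq_nonneg t) (neg_nonneg.2 (not_lt.1 hneg))
      linarith
    have : (c * R * v₁ * cosh t) * sinh t = (c * R * cosh t) * (v₁ * sinh t) := by ring
    rw [this]
    positivity
  have hy : c * R * v₁ * cosh t = sinh t := by
    have hsq : (c * R * v₁ * cosh t) ^ 2 = sinh t ^ 2 := by
      rw [mul_pow, hy2, hc, hs]; norm_num
    rcases sq_eq_sq_iff_eq_or_eq_neg.1 hsq with h5 | h5
    · exact h5
    · rw [h5] at hsign
      nlinarith
  have hy' : c * R * v₁ * (2 * sinh (2 * t)) = cosh (2 * t) := by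
    rw [sinh_two_mul, hc2]
    linear_combination (4 * sinh t) * hy + 4 * hs
  have hb1 : c * (v₁ * cosh t) = R⁻¹ * sinh t := by
    rw [← hy]; field_simp
  have hb2 : c * (2 * (v₁ * sinh (2 * t))) = R⁻¹ * cosh (2 * t) := by
    rw [← hy']; field_simp
  have hcR : (c * R)⁻¹ * c = R⁻¹ := by field_simp
  rw [h.d_eq, h.eq, fderiv_phiFun_apply, smul_smul, hcR]
  ext i
  fin_cases i
  · simp [phiFun]; linear_combination (2 * cos θ) * hb1
  · simp [phiFun]; linear_combination (2 * sin θ) * hb1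
  · simp [phiFun]; linear_combination (cos (2 * θ)) * hb2
  · simp [phiFun]; linear_combination (sin (2 * θ)) * hb2

theorem coordinate_sinh (h : ψ.IsDilationOfPhi c) {T : ℝ} (hT : 0 < T) :
    (ψ.metric T).IsSteklovEigenfunction (cosh T / sinh T / √((ψ.metric T).G (T, 0)))
      (fun p => ψ.toFun p 0) ∧
    (ψ.metric T).IsSteklovEigenfunction (cosh T / sinh T / √((ψ.metric T).G (T, 0)))
      (fun p => ψ.toFun p 1) := by
  have hA : c * 2 ≠ 0 := mul_ne_zero h.pos.ne' two_ne_zero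
  constructor
  · have e : (fun p => ψ.toFun p 0) =
        Metric.IsIsothermal.mode id (fun _ => 0) (fun x => c * 2 * sinh x) 1 0 := by
      ext p
      simp [h.eq, phiFun, Metric.IsIsothermal.mode]
      ring
    rw [e]
    exact (h.isIsothermal T).isSteklovEigenfunction_sinh hT hA 0
  · have e : (fun p => ψ.toFun p 1) =
        Metric.IsIsothermal.mode id (fun _ => 0) (fun x => c * 2 * sinh x) 1 (-(π / 2)) := by
      ext p
      simp [h.eq, phiFun, Metric.IsIsothermal.mode, ← sub_eq_add_neg, cos_sub_pi_div_two]
      ring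
    rw [e]
    exact (h.isIsothermal T).isSteklovEigenfunction_sinh hT hA (-(π / 2))

theorem coordinate_cosh (h : ψ.IsDilationOfPhi c) {T : ℝ} (hT : 0 < T) :
    (ψ.metric T).IsSteklovEigenfunction (2 * tanh (2 * T) / √((ψ.metric T).G (T, 0)))
      (fun p => ψ.toFun p 2) ∧
    (ψ.metric T).IsSteklovEigenfunction (2 * tanh (2 * T) / √((ψ.metric T).G (T, 0)))
      (fun p => ψ.toFun p 3) := by
  constructor
  · have e : (fun p => ψ.toFun p 2) =
        Metric.IsIsothermal.mode id (fun _ => 0) (fun x => c * cosh (2 * x)) 2 0 := by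
      ext p
      simp [h.eq, phiFun, Metric.IsIsothermal.mode]
      ring
    rw [e]
    exact (h.isIsothermal T).isSteklovEigenfunction_cosh hT h.pos.ne' 0
  · have e : (fun p => ψ.toFun p 3) =
        Metric.IsIsothermal.mode id (fun _ => 0) (fun x => c * cosh (2 * x)) 2 (-(π / 2)) := by
      ext p
      simp [h.eq, phiFun, Metric.IsIsothermal.mode, ← sub_eq_add_neg, cos_sub_pi_div_two]
      ring
    rw [e]
    exact (h.isIsothermal T).isSteklovEigenfunction_cosh hT h.pos.ne' (-(π / 2))

end IsDilationOfPhi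

end Immersion

/-- A function that does not vanish on the boundary is an eigenfunction for at most one
eigenvalue. -/
theorem Metric.IsSteklovEigenfunction.eigenvalue_unique {T : ℝ} {g : Metric T} (hT : 0 < T)
    {u : ℝ × ℝ → ℝ} {σ τ : ℝ} (h₁ : g.IsSteklovEigenfunction σ u)
    (h₂ : g.IsSteklovEigenfunction τ u) {θ : ℝ} (hne : u (T, θ) ≠ 0) : σ = τ := by
  have hr := Real.sqrt_pos.2 (g.G_pos (mem_strip.2 ⟨by linarith, le_rfl⟩ : (T, θ) ∈ strip T))
  have := (h₁.fluxT_boundary hT θ).symm.trans (h₂.fluxT_boundary hT θ)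
  exact mul_right_cancel₀ hr.ne' (mul_right_cancel₀ hne this)

theorem Immersion.IsDilationOfPhi.isByFirstEigenfunctions_iff {ψ : Immersion} {c : ℝ}
    (h : ψ.IsDilationOfPhi c) {T : ℝ} (hT : 0 < T) :
    ψ.IsByFirstEigenfunctions T ↔ T = criticalT := by
  have hr := Real.sqrt_pos.2
    ((ψ.metric T).G_pos (mem_strip.2 ⟨by linarith, le_rfl⟩ : (T, (0 : ℝ)) ∈ strip T))
  constructor
  · intro hfirst
    have h0 := (h.coordinate_sinh hT).1.eigenvalue_unique hT (hfirst 0).2 (θ := 0) (by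
      simp [h.eq, phiFun, h.pos.ne', hT.ne'])
    have h2 := (h.coordinate_cosh hT).1.eigenvalue_unique hT (hfirst 2).2 (θ := 0) (by
      simp [h.eq, phiFun, h.pos.ne', (cosh_pos _).ne'])
    rw [← coth_eq_iff hT]
    exact (div_left_inj' hr.ne').1 (h0.trans h2.symm)
  · rintro rfl
    have hσ : (ψ.metric criticalT).sigmaOne = √3 / √((ψ.metric criticalT).G (criticalT, 0)) := by
      rw [(h.isIsothermal criticalT).sigmaOne_eq hT, id, flatSigma_criticalT]
    have h1 := h.coordinate_sinh hT
    have h2 := h.coordinate_cosh hT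
    rw [coth_criticalT, ← hσ] at h1
    rw [two_mul_tanh_criticalT, ← hσ] at h2
    intro i
    refine ⟨(h.isIsothermal criticalT).isLeast_sigmaOne hT, ?_⟩
    fin_cases i
    exacts [h1.1, h1.2, h2.1, h2.2]

end Mobius

end

theorem mainTheorem12 :
    -- the explicit map is a minimal embedding of the Möbius band
    Topology.IsEmbedding Mobius.phi.onBand ∧ Mobius.phi.IsMinimal ∧
    ∃ T₀ : ℝ,
      -- `T₀` is the unique positive solution of `coth t = 2 tanh 2t`
      (∀ t : ℝ, (0 < t ∧ Real.cosh t / Real.sinh t = 2 * Real.tanh (2 * t)) ↔ t = T₀) ∧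
      -- `T₀` is the unique half-width for which the restriction of the map is a proper embedding
      -- in a ball by first Steklov eigenfunctions
      (∀ T : ℝ, 0 < T → ((∃ R : ℝ, 0 < R ∧ Mobius.phi.IsProperEmbeddingInBall T R ∧
        Mobius.phi.IsByFirstEigenfunctions T) ↔ T = T₀)) ∧
      -- it is then a free boundary surface
      Mobius.phi.IsProperEmbeddingInBall T₀ (Mobius.radius T₀) ∧
      Mobius.phi.MeetsBallOrthogonally T₀ (Mobius.radius T₀) ∧
      -- the critical Möbius band: rescaling to the unit ball
      (Mobius.unitPhi T₀).IsMinimal ∧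
      (Mobius.unitPhi T₀).IsProperEmbeddingInBall T₀ 1 ∧
      (Mobius.unitPhi T₀).MeetsBallOrthogonally T₀ 1 ∧
      (Mobius.unitPhi T₀).IsByFirstEigenfunctions T₀ ∧
      -- the first nonzero eigenvalue exists, and the normalized eigenvalue is at most `2π√3`
      (∀ T : ℝ, 0 < T → ∀ g : Mobius.Metric T, g.IsRotationallySymmetric →
        IsLeast g.positiveSteklovSpectrum g.sigmaOne ∧
        g.sigmaOne * g.boundaryLength ≤ 2 * Real.pi * √3) ∧
      -- the bound is attained by the critical Möbius band
      ((Mobius.unitPhi T₀).metric T₀).IsRotationallySymmetric ∧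
      ((Mobius.unitPhi T₀).metric T₀).sigmaOne * ((Mobius.unitPhi T₀).metric T₀).boundaryLength
        = 2 * Real.pi * √3 ∧
      -- and, up to `σ`-homothety, only by it
      (∀ T : ℝ, 0 < T → ∀ g : Mobius.Metric T, g.IsRotationallySymmetric →
        g.sigmaOne * g.boundaryLength = 2 * Real.pi * √3 →
        g.SigmaHomothetic ((Mobius.unitPhi T₀).metric T₀)) := by
  have hU := Mobius.Immersion.isDilationOfPhi_unitPhi Mobius.criticalT
  have hP := Mobius.Immersion.isDilationOfPhi_phi
  have hT := Mobius.criticalT_pos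
  have hR := (Mobius.radius_pos Mobius.criticalT).ne'
  have hball := hU.isProperEmbeddingInBall hT
  have horth := hU.meetsBallOrthogonally
  rw [inv_mul_cancel₀ hR] at hball horth
  have hPball : ∀ T : ℝ, 0 < T → Mobius.phi.IsProperEmbeddingInBall T (Mobius.radius T) :=
    fun T hT => by simpa using hP.isProperEmbeddingInBall hT
  refine ⟨Mobius.isClosedEmbedding_phi.isEmbedding, hP.isMinimal, Mobius.criticalT, ?_, ?_,
    hPball _ hT, by simpa using hP.meetsBallOrthogonally, hU.isMinimal, hball, horth,
    (hU.isByFirstEigenfunctions_iff hT).2 rfl, ?_, hU.isRotationallySymmetric _, ?_, ?_⟩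
  · exact fun t => ⟨fun h => (Mobius.coth_eq_iff h.1).1 h.2,
      fun h => by rw [h]; exact ⟨hT, (Mobius.coth_eq_iff hT).2 rfl⟩⟩
  · refine fun T hT => ⟨fun ⟨_, _, _, h⟩ => (hP.isByFirstEigenfunctions_iff hT).1 h, fun h =>
      ⟨Mobius.radius T, Mobius.radius_pos T, hPball T hT, (hP.isByFirstEigenfunctions_iff hT).2 h⟩⟩
  · intro T hT g hg
    obtain ⟨s, a, H⟩ := hg.exists_isIsothermal hT
    refine ⟨H.isLeast_sigmaOne hT, ?_⟩
    rw [H.sigmaOne_mul_boundaryLength hT]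
    exact mul_le_mul_of_nonneg_left (Mobius.flatSigma_le_sqrt_three _) Real.two_pi_pos.le
  · rw [(hU.isIsothermal _).sigmaOne_mul_boundaryLength hT, id, Mobius.flatSigma_criticalT]
  · intro T hT g hg heq
    obtain ⟨s, a, H⟩ := hg.exists_isIsothermal hT
    rw [H.sigmaOne_mul_boundaryLength hT, mul_right_inj' Real.two_pi_pos.ne'] at heq
    refine H.sigmaHomothetic hT (hU.isIsothermal _) ?_
    by_contra hne
    exact (Mobius.flatSigma_lt hne).ne heq
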